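/- Let $m,n\ge 1$ be integers with $n+m\ge 3$, let $\Theta\in\mathbb R^{n\times m}$, $\eta\in\mathbb R^n$, and let $\sigma=(\sigma_1,\dots,\sigma_m)$, $\rho=(\rho_1,\dots,\rho_n)$ be weights, i.e. positive reals with $\sigma_1\ge\dots\ge\sigma_m$, $\rho_1\ge\dots\ge\rho_n$, $\sum_j\sigma_j=\sum_i\rho_i=1$. Put $|x|_\sigma=\max_j|x_j|^{1/\sigma_j}$ for $x\in\mathbb R^m$ and $|y|_\rho=\max_i|y_i|^{1/\rho_i}$ for $y\in\mathbb R^n$. Let $\omega_\eta\in[-\infty,+\infty]$ (respectively $\hat\omega_\eta$) be the supremum of the real $\gamma$ such that the system $$|x|_\sigma\le t,\qquad |\Theta x-y-\eta|_\rho\le t^{-\gamma}$$ admits a nonzero solution $(x,y)\in\mathbb Z^{m}\times\mathbb Z^n$ for some arbitrarily large $t$ (respectively for every $t$ large enough). Let $\omega$ and $\hat\omega$ be the corresponding suprema for the homogeneous system, i.e. for $\eta=0$. We use the conventions $(+\infty)-c=+\infty$ for real $c$, $(+\infty)^{-1}=0$, and $c/(+\infty)=0$ for real $c$. (i) Suppose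 $n=1$. Then $$\hat\omega_\eta\ \ge\ \frac{\sigma_m}{\omega-(1-\sigma_m)},$$ and, if $\Theta\notin\mathbb Q^{1\times m}$, $$\omega_\eta\ \ge\ \frac{\sigma_m}{1-(1-\sigma_m)\hat\omega^{-1}}.$$ (ii) Suppose $m=1$ and $\omega<(1-\rho_n)^{-1}$. Then $$\hat\omega_\eta\ \ge\ \frac{\omega^{-1}-(1-\rho_n)}{\rho_n},\qquad \omega_\eta\ \ge\ \frac{1-(1-\rho_n)\hat\omega}{\rho_n}.$$ -/

import Mathlib

/-- The weighted norm `|v|_w = max_i |v_i|^(1 / w_i)` on `ℝ^k` (the maximum is over a finite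
index set, which is nonempty wherever this is used). -/
noncomputable def weightedNorm {k : ℕ} (w : Fin k → ℝ) (v : Fin k → ℝ) : ℝ :=
  ⨆ i, |v i| ^ (1 / w i)

/-- The system `|x|_σ ≤ t`, `|Θ x - y - η|_ρ ≤ t ^ (-γ)` admits a nonzero solution `(x, y)` in
integer vectors. -/
def HasNonzeroSolution {m n : ℕ} (σ : Fin m → ℝ) (ρ : Fin n → ℝ)
    (Θ : Matrix (Fin n) (Fin m) ℝ) (η : Fin n → ℝ) (γ t : ℝ) : Prop :=
  ∃ (x : Fin m → ℤ) (y : Fin n → ℤ), (x, y) ≠ 0 ∧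
    weightedNorm σ (fun j => (x j : ℝ)) ≤ t ∧
    weightedNorm ρ (fun i => Θ.mulVec (fun j => (x j : ℝ)) i - (y i : ℝ) - η i) ≤ t ^ (-γ)

/-- The inhomogeneous weighted Diophantine exponent: the supremum (possibly infinite) of the real
`γ` for which there is a nonzero solution for some arbitrarily large `t`. -/
noncomputable def inhomExponent {m n : ℕ} (σ : Fin m → ℝ) (ρ : Fin n → ℝ)
    (Θ : Matrix (Fin n) (Fin m) ℝ) (η : Fin n → ℝ) : EReal :=
  sSup {g : EReal | ∃ γ : ℝ, g = (γ : EReal) ∧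
    ∀ T : ℝ, ∃ t : ℝ, T ≤ t ∧ HasNonzeroSolution σ ρ Θ η γ t}

/-- The inhomogeneous uniform weighted Diophantine exponent: the supremum (possibly infinite) of
the real `γ` for which there is a nonzero solution for every `t` large enough. -/
noncomputable def inhomUniformExponent {m n : ℕ} (σ : Fin m → ℝ) (ρ : Fin n → ℝ)
    (Θ : Matrix (Fin n) (Fin m) ℝ) (η : Fin n → ℝ) : EReal :=
  sSup {g : EReal | ∃ γ : ℝ, g = (γ : EReal) ∧
    ∃ T : ℝ, ∀ t : ℝ, T ≤ t → HasNonzeroSolution σ ρ Θ η γ t}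

/-- The weighted Diophantine exponent: the homogeneous case `η = 0`. -/
noncomputable def weightedExponent {m n : ℕ} (σ : Fin m → ℝ) (ρ : Fin n → ℝ)
    (Θ : Matrix (Fin n) (Fin m) ℝ) : EReal :=
  inhomExponent σ ρ Θ 0

/-- The uniform weighted Diophantine exponent: the homogeneous case `η = 0`. -/
noncomputable def weightedUniformExponent {m n : ℕ} (σ : Fin m → ℝ) (ρ : Fin n → ℝ)
    (Θ : Matrix (Fin n) (Fin m) ℝ) : EReal :=
  inhomUniformExponent σ ρ Θ 0

/-- A system of weights: positive reals in non-increasing order whose sum is `1`. -/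
structure IsWeight {k : ℕ} (w : Fin k → ℝ) : Prop where
  pos : ∀ i, 0 < w i
  anti : Antitone w
  sum_eq_one : ∑ i, w i = 1

/-- The last (smallest) entry `w_k` of a vector `(w_1, …, w_k)`, `k ≥ 1`. -/
def lastEntry {k : ℕ} (hk : 0 < k) (w : Fin k → ℝ) : ℝ :=
  w ⟨k - 1, Nat.sub_lt hk Nat.one_pos⟩

/-! Two principles combine. The first is a duality between inhomogeneous approximation for Θ and
homogeneous approximation for its transpose: `inv_le_inhomUniformExponent` and
`inv_le_inhomExponent` say that ω̂_η ≥ 1/ω(Θᵀ) and ω_η ≥ 1/ω̂(Θᵀ). Both rest on the quantitative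
Kronecker theorem `exists_inhomogeneous_solution`. There one sums e(u·(Θx − η)) over integer vectors
x and u, weighted by powers of Fejér kernels. If the inhomogeneous system has no solution, the sum
over u is tiny for every x; if the transposed homogeneous system has none, the sum over x is tiny
for every u ≠ 0. The terms with u = 0 are then too large to be balanced.

The second is transference between a linear form and simultaneous approximation. Let s be the least
weight on the side of dimension at least 2. For a row Θ, with ω' and ω̂' the exponents of Θᵀ, one
has ω ≥ (1 − s) + sω' and ω̂ ≥ (1 − s)/(1 − sω̂'). For a column Θ, ω ≥ ω'/(ω'(1 − s) + s) and ω̂ ≥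
(1 − s/ω̂')/(1 − s). Solving for ω' and ω̂' and inserting the result into the duality gives the four
bounds.

Transference takes place in a box. A good approximation for Θᵀ is a short vector of the dual
lattice, and Minkowski's theorem yields a lattice point orthogonal to it whose remaining coordinates
are small; orthogonality controls the last one (`exists_int_of_dual_vector`). This suffices for the
ordinary exponents. For the uniform ones a single dual vector may be too long in one coordinate;
then two independent dual vectors are used, and only their 2×2 minors have to be small
(`exists_int_of_dual_pair`). -/

/-! ### Geometry of numbers: lattice points orthogonal to dual vectors. -/

/-- Minkowski's theorem on linear forms. -/
theorem exists_int_abs_mulVec_lt {ι : Type*} [Fintype ι] [DecidableEq ι] (N : Matrix ι ι ℝ)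
    (c : ι → ℝ) (hc : ∀ i, 0 < c i) (hN : N.det ≠ 0) (h : |N.det| < ∏ i, c i) :
    ∃ z : ι → ℤ, z ≠ 0 ∧ ∀ i, |N.mulVec (fun j => (z j : ℝ)) i| < c i := by
  classical
  let b := Pi.basisFun ℝ ι
  let L : AddSubgroup (ι → ℝ) := (Submodule.span ℤ (Set.range b)).toAddSubgroup
  let S : Set (ι → ℝ) := (Matrix.toLin' N) ⁻¹' (Set.univ.pi fun i => Set.Ioo (-c i) (c i))
  have hdet : LinearMap.det (Matrix.toLin' N) = N.det := LinearMap.det_toLin' N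
  have hsymm : ∀ x ∈ S, -x ∈ S := by
    intro x hx i hi
    have := hx i hi
    simp only [Set.mem_Ioo, map_neg, Pi.neg_apply] at this ⊢
    constructor <;> linarith [this.1, this.2]
  have hconv : Convex ℝ S :=
    (convex_pi fun i _ => convex_Ioo _ _).linear_preimage (Matrix.toLin' N)
  have hvol : MeasureTheory.volume S = ENNReal.ofReal (|N.det|⁻¹ * ∏ i, (2 * c i)) := by
    rw [MeasureTheory.Measure.addHaar_preimage_linearMap _ (by rwa [hdet]), hdet,
      Real.volume_pi_Ioo, ← ENNReal.ofReal_prod_of_nonneg (fun i _ => by linarith [hc i]),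
      ← ENNReal.ofReal_mul (abs_nonneg _), abs_inv]
    congr 3
    ext i
    ring
  have hfund := ZSpan.isAddFundamentalDomain b (MeasureTheory.volume)
  have hvolF : MeasureTheory.volume (ZSpan.fundamentalDomain b) = 1 := by
    rw [ZSpan.volume_fundamentalDomain]
    have : Matrix.of (b : ι → ι → ℝ) = 1 := by
      ext i j
      simp [b, Pi.single_apply, Matrix.one_apply, eq_comm]
    rw [this]
    simp
  have hlt : MeasureTheory.volume (ZSpan.fundamentalDomain b) * 2 ^ Module.finrank ℝ (ι → ℝ)
      < MeasureTheory.volume S := by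
    rw [hvolF, hvol, one_mul, Module.finrank_fintype_fun_eq_card, Finset.prod_mul_distrib,
      Finset.prod_const, Finset.card_univ]
    have h2 : (2 : ENNReal) ^ Fintype.card ι = ENNReal.ofReal (2 ^ Fintype.card ι) := by
      rw [ENNReal.ofReal_pow (by norm_num)]
      simp
    rw [h2]
    have hp : 0 < |N.det| := abs_pos.2 hN
    have h1 : 1 < |N.det|⁻¹ * ∏ i, c i := by
      rw [inv_mul_eq_div, one_lt_div hp]
      exact h
    refine (ENNReal.ofReal_lt_ofReal_iff ?_).2 ?_
    · have : 0 < ∏ i, c i := Finset.prod_pos fun i _ => hc i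
      positivity
    · have h3 : (0 : ℝ) < 2 ^ Fintype.card ι := by positivity
      nlinarith
  have : Countable L := by
    change Countable (Submodule.span ℤ (Set.range b))
    infer_instance
  obtain ⟨⟨x, hxL⟩, hx0, hxS⟩ :=
    MeasureTheory.exists_ne_zero_mem_lattice_of_measure_mul_two_pow_lt_measure
      (L := L) hfund hsymm hconv hlt
  have hx' : ∀ i, ∃ k : ℤ, (k : ℝ) = x i := by
    have := (b.mem_span_iff_repr_mem ℤ x).1 hxL
    intro i
    obtain ⟨k, hk⟩ := this i
    exact ⟨k, by simpa [b] using hk⟩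
  choose z hz using hx'
  have hzx : (fun j => (z j : ℝ)) = x := funext hz
  refine ⟨z, ?_, ?_⟩
  · rintro rfl
    apply hx0
    ext i
    simp [← hz i]
  · intro i
    rw [hzx, abs_lt]
    simpa using hxS i (Set.mem_univ i)

/-- A coordinate of a vector orthogonal to `f` is controlled by the other ones. -/
theorem abs_le_of_dotProduct_eq_zero {ι : Type*} [Fintype ι] {f y c : ι → ℝ} {K : ℝ} (i₀ : ι)
    (hK : 0 ≤ K) (h0 : f i₀ ≠ 0) (hmax : ∀ i, |f i| * c i ≤ |f i₀| * c i₀)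
    (hc : ∀ i, 0 < c i) (hy : ∀ i, i ≠ i₀ → f i ≠ 0 → |y i| ≤ K * c i)
    (horth : ∑ i, f i * y i = 0) :
    |y i₀| ≤ Fintype.card ι * K * c i₀ := by
  classical
  have hf : 0 < |f i₀| := abs_pos.2 h0
  have h1 : f i₀ * y i₀ = -∑ i ∈ Finset.univ.erase i₀, f i * y i := by
    rw [← Finset.add_sum_erase _ _ (Finset.mem_univ i₀)] at horth
    linarith
  have h2 : |f i₀| * |y i₀| ≤ ∑ i ∈ Finset.univ.erase i₀, K * (|f i₀| * c i₀) := by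
    rw [← abs_mul, h1, abs_neg]
    refine (Finset.abs_sum_le_sum_abs _ _).trans (Finset.sum_le_sum fun i hi => ?_)
    have hi' : i ≠ i₀ := Finset.ne_of_mem_erase hi
    rw [abs_mul]
    by_cases hfi : f i = 0
    · rw [hfi, abs_zero, zero_mul]
      exact mul_nonneg hK (mul_nonneg hf.le (hc _).le)
    · calc |f i| * |y i| ≤ |f i| * (K * c i) :=
            mul_le_mul_of_nonneg_left (hy i hi' hfi) (abs_nonneg _)
        _ = K * (|f i| * c i) := by ring
        _ ≤ _ := mul_le_mul_of_nonneg_left (hmax i) hK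
  have h3 : ∑ i ∈ Finset.univ.erase i₀, K * (|f i₀| * c i₀)
      ≤ Fintype.card ι * (K * (|f i₀| * c i₀)) := by
    rw [Finset.sum_const, nsmul_eq_mul]
    refine mul_le_mul_of_nonneg_right ?_ (mul_nonneg hK (mul_nonneg hf.le (hc _).le))
    exact_mod_cast (Finset.card_le_univ _)
  refine le_of_mul_le_mul_left ?_ hf
  calc |f i₀| * |y i₀| ≤ _ := h2.trans h3
    _ = _ := by ring

theorem det_updateRow_vecMul {ι : Type*} [Fintype ι] [DecidableEq ι] (M : Matrix ι ι ℝ) (i : ι)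
    (f : ι → ℝ) : (M.updateRow i (Matrix.vecMul f M)).det = f i * M.det := by
  have : Matrix.vecMul f M = ∑ k, f k • M k := by
    ext j
    simp [Matrix.vecMul, dotProduct]
  rw [this, Matrix.det_updateRow_sum, smul_eq_mul]

theorem int_dotProduct_eq_zero_of_abs_lt {ι : Type*} [Fintype ι] {u z : ι → ℤ}
    (h : |(fun i => (u i : ℝ)) ⬝ᵥ fun i => (z i : ℝ)| < 1) :
    (fun i => (u i : ℝ)) ⬝ᵥ (fun i => (z i : ℝ)) = 0 := by
  have e : (fun i => (u i : ℝ)) ⬝ᵥ (fun i => (z i : ℝ)) = ((u ⬝ᵥ z : ℤ) : ℝ) := by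
    simp [dotProduct]
  rw [e] at h ⊢
  have : |u ⬝ᵥ z| < 1 := by exact_mod_cast h
  rw [Int.abs_lt_one_iff] at this
  simp [this]

theorem prod_lt_prod_two_mul {ι : Type*} {s : Finset ι} (hs : s.Nonempty) {c : ι → ℝ}
    (hc : ∀ i, 0 < c i) : ∏ i ∈ s, c i < ∏ i ∈ s, 2 * c i :=
  Finset.prod_lt_prod_of_nonempty (fun i _ => hc i) (fun i _ => by linarith [hc i]) hs

/-- A lattice vector orthogonal to one given vector of the dual lattice. -/
theorem exists_int_of_dual_vector {ι : Type*} [Fintype ι] [DecidableEq ι] [Nontrivial ι]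
    {M : Matrix ι ι ℝ} (hM : |M.det| = 1) {c : ι → ℝ} (hc : ∀ i, 0 < c i) {f : ι → ℝ}
    {u : ι → ℤ} (hu : Matrix.vecMul f M = fun i => (u i : ℝ)) (hf : f ≠ 0)
    (hfc : ∀ i, |f i| * c i ≤ ∏ j, c j) :
    ∃ z : ι → ℤ, z ≠ 0 ∧
      ∀ i, |M.mulVec (fun j => (z j : ℝ)) i| ≤ 2 * Fintype.card ι ^ 2 * c i := by
  obtain ⟨i₀, -, hmax⟩ := Finset.exists_max_image Finset.univ (fun i => |f i| * c i)
    Finset.univ_nonempty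
  replace hmax : ∀ i, |f i| * c i ≤ |f i₀| * c i₀ := fun i => hmax i (Finset.mem_univ i)
  have h0 : f i₀ ≠ 0 := by
    intro h
    apply hf
    ext i
    have := hmax i
    rw [h, abs_zero, zero_mul] at this
    have h2 : |f i| ≤ 0 := by
      by_contra h3
      nlinarith [hc i, not_le.1 h3, mul_pos (not_le.1 h3) (hc i)]
    simpa using h2
  have hMdet : M.det ≠ 0 := by
    intro h
    simp [h] at hM
  have hdet := det_updateRow_vecMul M i₀ f
  rw [hu] at hdet
  -- The bound 1 in row i₀ forces the integer u·z to vanish; the factors 2 elsewhere make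
  -- Minkowski's inequality strict.
  set e : ι → ℝ := Function.update (fun i => 2 * c i) i₀ 1 with he
  have hpe : ∏ i, e i = ∏ i ∈ Finset.univ.erase i₀, 2 * c i := by
    rw [← Finset.mul_prod_erase _ _ (Finset.mem_univ i₀)]
    simp only [he, Function.update_self, one_mul]
    exact Finset.prod_congr rfl fun i hi => by
      rw [Function.update_of_ne (Finset.ne_of_mem_erase hi)]
  obtain ⟨z, hz0, hz⟩ := exists_int_abs_mulVec_lt
    (M.updateRow i₀ fun i => (u i : ℝ)) e
    (by
      intro i
      by_cases hi : i = i₀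
      · subst hi; simp [he]
      · simp [he, hi, hc i])
    (by rw [hdet]; exact mul_ne_zero h0 hMdet)
    (by
      rw [hdet, abs_mul, hM, mul_one, hpe]
      have hne : (Finset.univ.erase i₀).Nonempty := by
        obtain ⟨j, hj⟩ := exists_ne i₀
        exact ⟨j, by simp [hj]⟩
      refine lt_of_le_of_lt ?_ (prod_lt_prod_two_mul hne hc)
      have := hfc i₀
      rw [← Finset.mul_prod_erase _ _ (Finset.mem_univ i₀), mul_comm] at this
      exact le_of_mul_le_mul_left this (hc _))
  refine ⟨z, hz0, ?_⟩
  have horth : ∑ i, f i * M.mulVec (fun j => (z j : ℝ)) i = 0 := by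
    change f ⬝ᵥ M.mulVec (fun j => (z j : ℝ)) = 0
    rw [Matrix.dotProduct_mulVec, hu]
    apply int_dotProduct_eq_zero_of_abs_lt
    simpa [he, Matrix.mulVec] using hz i₀
  have hother : ∀ i, i ≠ i₀ → |M.mulVec (fun j => (z j : ℝ)) i| ≤ 2 * c i := by
    intro i hi
    simpa [he, Matrix.mulVec, hi] using (hz i).le
  have hcard : (1 : ℝ) ≤ Fintype.card ι := by exact_mod_cast Fintype.card_pos
  intro i
  by_cases hi : i = i₀
  · subst hi
    refine (abs_le_of_dotProduct_eq_zero (K := 2) i (by norm_num) h0 hmax hc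
      (fun j hj _ => hother j hj) horth).trans ?_
    refine mul_le_mul_of_nonneg_right ?_ (hc i).le
    nlinarith
  · refine (hother i hi).trans (mul_le_mul_of_nonneg_right ?_ (hc i).le)
    nlinarith

/-- A lattice vector orthogonal to two given independent vectors of the dual lattice. -/
theorem exists_int_of_dual_pair {ι : Type*} [Fintype ι] [DecidableEq ι]
    (hι : 3 ≤ Fintype.card ι)
    {M : Matrix ι ι ℝ} (hM : |M.det| = 1) {c : ι → ℝ} (hc : ∀ i, 0 < c i) {f f' : ι → ℝ}
    {u u' : ι → ℤ} (hu : Matrix.vecMul f M = fun i => (u i : ℝ))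
    (hu' : Matrix.vecMul f' M = fun i => (u' i : ℝ)) (i₀ : ι)
    (hmax : ∀ i, |f i| * c i ≤ |f i₀| * c i₀)
    (hw : ∀ j, |f i₀ * f' j - f' i₀ * f j| * (c j * c i₀) ≤ ∏ i, c i)
    (hne : ∃ j, f i₀ * f' j - f' i₀ * f j ≠ 0) :
    ∃ z : ι → ℤ, z ≠ 0 ∧
      ∀ i, |M.mulVec (fun j => (z j : ℝ)) i| ≤ 2 * Fintype.card ι ^ 2 * c i := by
  -- The combination of f and f' that eliminates coordinate i₀; its entries are the 2×2 minors
  -- through that coordinate.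
  set w : ι → ℝ := fun j => f i₀ * f' j - f' i₀ * f j with hwdef
  have : Nonempty ι := ⟨i₀⟩
  obtain ⟨j₀, -, hmaxw⟩ := Finset.exists_max_image Finset.univ (fun i => |w i| * c i)
    Finset.univ_nonempty
  replace hmaxw : ∀ i, |w i| * c i ≤ |w j₀| * c j₀ := fun i => hmaxw i (Finset.mem_univ i)
  have hwj : w j₀ ≠ 0 := by
    intro h
    obtain ⟨i, hi⟩ := hne
    have := hmaxw i
    rw [h, abs_zero, zero_mul] at this
    exact absurd (mul_pos (abs_pos.2 hi) (hc i)) (not_lt.2 this)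
  have hwi : w i₀ = 0 := by simp only [hwdef]; ring
  have hij : i₀ ≠ j₀ := fun h => hwj (h ▸ hwi)
  have h0 : f i₀ ≠ 0 := by
    intro h
    have := hmax j₀
    rw [h, abs_zero, zero_mul] at this
    have h2 : f j₀ = 0 := by
      by_contra h3
      exact absurd (mul_pos (abs_pos.2 h3) (hc j₀)) (not_lt.2 this)
    exact hwj (by simp [hwdef, h, h2])
  have hMdet : M.det ≠ 0 := by
    intro h
    simp [h] at hM
  set M₁ := M.updateRow i₀ (fun i => (u i : ℝ)) with hM₁
  have hdet₁ : M₁.det = f i₀ * M.det := by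
    rw [hM₁, ← hu]; exact det_updateRow_vecMul M i₀ f
  -- The coordinates of u' with respect to the rows of `M₁`, so the second row replacement
  -- multiplies the determinant by `w j₀ / f i₀`.
  set g : ι → ℝ := Function.update (fun j => w j / f i₀) i₀ (f' i₀ / f i₀) with hg
  have hgM : Matrix.vecMul g M₁ = fun i => (u' i : ℝ) := by
    have e1 : ∀ j, u' j = ∑ i, f' i * M i j := fun j => by
      have := congrFun hu' j
      simpa [Matrix.vecMul, dotProduct] using this.symm
    have e2 : ∀ j, u j = ∑ i, f i * M i j := fun j => by
      have := congrFun hu j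
      simpa [Matrix.vecMul, dotProduct] using this.symm
    ext j
    simp only [Matrix.vecMul, dotProduct]
    rw [← Finset.add_sum_erase _ _ (Finset.mem_univ i₀)]
    have e3 : ∑ i ∈ Finset.univ.erase i₀, g i * M₁ i j
        = ∑ i ∈ Finset.univ.erase i₀, w i / f i₀ * M i j :=
      Finset.sum_congr rfl fun i hi => by
        have hi' := Finset.ne_of_mem_erase hi
        rw [hg, Function.update_of_ne hi', hM₁, Matrix.updateRow_ne hi']
    have e4 : ∑ i ∈ Finset.univ.erase i₀, w i / f i₀ * M i j = ∑ i, w i / f i₀ * M i j := by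
      rw [← Finset.add_sum_erase Finset.univ _ (Finset.mem_univ i₀), hwi]
      simp
    have e5 : ∑ i, w i / f i₀ * M i j = u' j - f' i₀ / f i₀ * u j := by
      rw [e1, e2, Finset.mul_sum, ← Finset.sum_sub_distrib]
      refine Finset.sum_congr rfl fun i _ => ?_
      simp only [hwdef]
      field_simp
    rw [e3, e4, e5, hg, Function.update_self, hM₁, Matrix.updateRow_self]
    ring
  set N := M₁.updateRow j₀ (fun i => (u' i : ℝ)) with hN
  have hdet : N.det = w j₀ * M.det := by
    rw [hN, ← hgM, det_updateRow_vecMul, hdet₁, hg, Function.update_of_ne hij.symm]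
    field_simp
  set s : Finset ι := (Finset.univ.erase i₀).erase j₀ with hs
  set e : ι → ℝ := Function.update (Function.update (fun i => 2 * c i) i₀ 1) j₀ 1 with he
  have hj₀mem : j₀ ∈ Finset.univ.erase i₀ := by simp [hij.symm]
  have hpe : ∏ i, e i = ∏ i ∈ s, 2 * c i := by
    rw [← Finset.mul_prod_erase _ _ (Finset.mem_univ i₀), ← Finset.mul_prod_erase _ _ hj₀mem]
    simp only [he, Function.update_self, one_mul, Function.update_of_ne hij]
    refine Finset.prod_congr rfl fun i hi => ?_
    have h1 := Finset.ne_of_mem_erase hi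
    have h2 := Finset.ne_of_mem_erase (Finset.mem_of_mem_erase hi)
    rw [Function.update_of_ne h1, Function.update_of_ne h2]
  have hpc : ∏ i, c i = c j₀ * c i₀ * ∏ i ∈ s, c i := by
    rw [← Finset.mul_prod_erase _ _ (Finset.mem_univ i₀), ← Finset.mul_prod_erase _ _ hj₀mem]
    ring
  have hsne : s.Nonempty := by
    rw [← Finset.card_pos, hs, Finset.card_erase_of_mem hj₀mem,
      Finset.card_erase_of_mem (Finset.mem_univ _), Finset.card_univ]
    omega
  obtain ⟨z, hz0, hz⟩ := exists_int_abs_mulVec_lt N e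
    (by
      intro i
      by_cases hi : i = j₀
      · subst hi; simp [he]
      · by_cases hi' : i = i₀
        · subst hi'; simp [he, hij]
        · simp [he, hi, hi', hc i])
    (by rw [hdet]; exact mul_ne_zero hwj hMdet)
    (by
      rw [hdet, abs_mul, hM, mul_one, hpe]
      refine lt_of_le_of_lt ?_ (prod_lt_prod_two_mul hsne hc)
      have := hw j₀
      rw [hpc, mul_comm] at this
      exact le_of_mul_le_mul_left this (mul_pos (hc _) (hc _)))
  refine ⟨z, hz0, ?_⟩
  have horth : ∑ i, f i * M.mulVec (fun j => (z j : ℝ)) i = 0 := by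
    change f ⬝ᵥ M.mulVec (fun j => (z j : ℝ)) = 0
    rw [Matrix.dotProduct_mulVec, hu]
    apply int_dotProduct_eq_zero_of_abs_lt
    simpa [he, hN, hM₁, Matrix.mulVec, hij] using hz i₀
  have horth' : ∑ i, f' i * M.mulVec (fun j => (z j : ℝ)) i = 0 := by
    change f' ⬝ᵥ M.mulVec (fun j => (z j : ℝ)) = 0
    rw [Matrix.dotProduct_mulVec, hu']
    apply int_dotProduct_eq_zero_of_abs_lt
    simpa [he, hN, Matrix.mulVec] using hz j₀
  have horthw : ∑ i, w i * M.mulVec (fun j => (z j : ℝ)) i = 0 := by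
    have : ∑ i, w i * M.mulVec (fun j => (z j : ℝ)) i
        = f i₀ * ∑ i, f' i * M.mulVec (fun j => (z j : ℝ)) i
          - f' i₀ * ∑ i, f i * M.mulVec (fun j => (z j : ℝ)) i := by
      rw [Finset.mul_sum, Finset.mul_sum, ← Finset.sum_sub_distrib]
      refine Finset.sum_congr rfl fun i _ => ?_
      simp only [hwdef]
      ring
    rw [this, horth, horth']
    ring
  have hother : ∀ i, i ≠ i₀ → i ≠ j₀ → |M.mulVec (fun j => (z j : ℝ)) i| ≤ 2 * c i := by
    intro i hi hi'
    simpa [he, hN, hM₁, Matrix.mulVec, hi, hi'] using (hz i).le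
  have hcard : (3 : ℝ) ≤ Fintype.card ι := by exact_mod_cast hι
  -- Coordinate j₀ is recovered from orthogonality to w, which does not involve i₀; then i₀ is
  -- recovered from f. Each recovery costs a factor card ι.
  have hj : |M.mulVec (fun j => (z j : ℝ)) j₀| ≤ Fintype.card ι * 2 * c j₀ :=
    abs_le_of_dotProduct_eq_zero (K := 2) j₀ (by norm_num) hwj hmaxw hc
      (fun i hi hi' => hother i (fun h => hi' (h ▸ hwi)) hi) horthw
  have hne₀ : ∀ i, i ≠ i₀ →
      |M.mulVec (fun j => (z j : ℝ)) i| ≤ (Fintype.card ι * 2) * c i := by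
    intro i hi
    by_cases hi' : i = j₀
    · rw [hi']; exact hj
    · refine (hother i hi hi').trans (mul_le_mul_of_nonneg_right ?_ (hc i).le)
      linarith
  intro i
  by_cases hi : i = i₀
  · rw [hi]
    refine (abs_le_of_dotProduct_eq_zero i₀ (by positivity) h0 hmax hc
      (fun j hj _ => hne₀ j hj) horth).trans (le_of_eq ?_)
    ring
  · refine (hne₀ i hi).trans (mul_le_mul_of_nonneg_right ?_ (hc i).le)
    nlinarith

/-! ### Systems of inequalities in a box, and transference between them. -/

/-- The system `|x_j| ≤ A_j`, `|(Θ x - y - η)_i| ≤ B_i` has a nonzero integer solution. -/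
def BoxSolution {m n : ℕ} (Θ : Matrix (Fin n) (Fin m) ℝ) (η : Fin n → ℝ) (A : Fin m → ℝ)
    (B : Fin n → ℝ) : Prop :=
  ∃ (x : Fin m → ℤ) (y : Fin n → ℤ), (x, y) ≠ 0 ∧ (∀ j, |(x j : ℝ)| ≤ A j) ∧
    ∀ i, |Θ.mulVec (fun j => (x j : ℝ)) i - (y i : ℝ) - η i| ≤ B i

theorem BoxSolution.mono {m n : ℕ} {Θ : Matrix (Fin n) (Fin m) ℝ} {η : Fin n → ℝ}
    {A A' : Fin m → ℝ} {B B' : Fin n → ℝ} (h : BoxSolution Θ η A B) (hA : ∀ j, A j ≤ A' j)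
    (hB : ∀ i, B i ≤ B' i) : BoxSolution Θ η A' B' := by
  obtain ⟨x, y, h0, h1, h2⟩ := h
  exact ⟨x, y, h0, fun j => (h1 j).trans (hA j), fun i => (h2 i).trans (hB i)⟩

/-- The matrix of `(x, y) ↦ (x, Θ x - y)`. -/
def approxMatrix {m n : ℕ} (Θ : Matrix (Fin n) (Fin m) ℝ) :
    Matrix (Fin m ⊕ Fin n) (Fin m ⊕ Fin n) ℝ :=
  Matrix.fromBlocks 1 0 Θ (-1)

theorem abs_det_approxMatrix {m n : ℕ} (Θ : Matrix (Fin n) (Fin m) ℝ) :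
    |(approxMatrix Θ).det| = 1 := by
  rw [approxMatrix, Matrix.det_fromBlocks_zero₁₂, Matrix.det_neg]
  simp

theorem approxMatrix_mulVec_inl {m n : ℕ} (Θ : Matrix (Fin n) (Fin m) ℝ) (z : Fin m ⊕ Fin n → ℝ)
    (j : Fin m) : (approxMatrix Θ).mulVec z (Sum.inl j) = z (Sum.inl j) := by
  rw [approxMatrix, Matrix.fromBlocks_mulVec]
  simp

theorem approxMatrix_mulVec_inr {m n : ℕ} (Θ : Matrix (Fin n) (Fin m) ℝ) (z : Fin m ⊕ Fin n → ℝ)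
    (i : Fin n) : (approxMatrix Θ).mulVec z (Sum.inr i)
      = Θ.mulVec (fun j => z (Sum.inl j)) i - z (Sum.inr i) := by
  rw [approxMatrix, Matrix.fromBlocks_mulVec]
  simp [Matrix.neg_mulVec, Function.comp_def, sub_eq_add_neg]

/-- Approximations (q, p) for the transposed matrix are thus vectors of the lattice dual to that of
Θ, which is why orthogonality arguments link the two systems. -/
theorem vecMul_approxMatrix {m n : ℕ} (Θ : Matrix (Fin n) (Fin m) ℝ) (q : Fin n → ℤ)
    (p : Fin m → ℤ) :
    Matrix.vecMul (Sum.elim (fun j => (p j : ℝ) - Θ.transpose.mulVec (fun i => (q i : ℝ)) j)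
      (fun i => (q i : ℝ))) (approxMatrix Θ)
      = fun k => ((Sum.elim p (-q) k : ℤ) : ℝ) := by
  rw [approxMatrix, Matrix.vecMul_fromBlocks]
  ext (j | i)
  · simp [Matrix.mulVec_transpose]
  · simp [Matrix.vecMul_neg]

theorem boxSolution_of_approxMatrix {m n : ℕ} {Θ : Matrix (Fin n) (Fin m) ℝ} {A : Fin m → ℝ}
    {B : Fin n → ℝ} {z : Fin m ⊕ Fin n → ℤ} (hz : z ≠ 0)
    (h : ∀ k, |(approxMatrix Θ).mulVec (fun k => (z k : ℝ)) k| ≤ Sum.elim A B k) :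
    BoxSolution Θ 0 A B := by
  refine ⟨fun j => z (Sum.inl j), fun i => z (Sum.inr i), ?_, fun j => ?_, fun i => ?_⟩
  · intro h0
    rw [Prod.mk_eq_zero] at h0
    apply hz
    ext (j | i)
    · exact congrFun h0.1 j
    · exact congrFun h0.2 i
  · have := h (Sum.inl j)
    rwa [approxMatrix_mulVec_inl] at this
  · have := h (Sum.inr i)
    rw [approxMatrix_mulVec_inr] at this
    simpa using this

theorem prod_sumElim {m n : ℕ} (A : Fin m → ℝ) (B : Fin n → ℝ) :
    ∏ k, Sum.elim A B k = (∏ j, A j) * ∏ i, B i := by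
  simp [Fintype.prod_sum_type]

theorem sumElim_pos {m n : ℕ} {A : Fin m → ℝ} {B : Fin n → ℝ} (hA : ∀ j, 0 < A j)
    (hB : ∀ i, 0 < B i) : ∀ k, 0 < Sum.elim A B k := by
  rintro (j | i)
  · exact hA j
  · exact hB i

/-- Dirichlet's theorem. -/
theorem boxSolution_of_one_lt_prod {m n : ℕ} (Θ : Matrix (Fin n) (Fin m) ℝ) {A : Fin m → ℝ}
    {B : Fin n → ℝ} (hA : ∀ j, 0 < A j) (hB : ∀ i, 0 < B i)
    (h : 1 < (∏ j, A j) * ∏ i, B i) : BoxSolution Θ 0 A B := by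
  obtain ⟨z, hz0, hz⟩ := exists_int_abs_mulVec_lt (approxMatrix Θ) (Sum.elim A B)
    (sumElim_pos hA hB)
    (by intro h0; have := abs_det_approxMatrix Θ; simp [h0] at this)
    (by rwa [abs_det_approxMatrix, prod_sumElim])
  exact boxSolution_of_approxMatrix hz0 fun k => (hz k).le

/-- The constant lost in the transference principle. -/
noncomputable def transferConst (m n : ℕ) : ℝ := 2 * ((m + n : ℕ) : ℝ) ^ 2

theorem elim_transferConst {m n : ℕ} (A : Fin m → ℝ) (B : Fin n → ℝ) (k : Fin m ⊕ Fin n) :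
    2 * (Fintype.card (Fin m ⊕ Fin n) : ℝ) ^ 2 * Sum.elim A B k
      = Sum.elim (fun j => transferConst m n * A j) (fun i => transferConst m n * B i) k := by
  rcases k with j | i <;> simp [transferConst]

/-- Transference from one solution of the transposed system. -/
theorem boxSolution_of_transpose {m n : ℕ} (hm : 0 < m) (hn : 0 < n)
    (Θ : Matrix (Fin n) (Fin m) ℝ)
    {A : Fin m → ℝ} {B : Fin n → ℝ} (hA : ∀ j, 0 < A j) (hB : ∀ i, 0 < B i)
    {q : Fin n → ℤ} {p : Fin m → ℤ} (h0 : (q, p) ≠ 0)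
    (hq : ∀ i, |(q i : ℝ)| * B i ≤ (∏ j, A j) * ∏ i, B i)
    (hp : ∀ j, |Θ.transpose.mulVec (fun i => (q i : ℝ)) j - p j| * A j
      ≤ (∏ j, A j) * ∏ i, B i) :
    BoxSolution Θ 0 (fun j => transferConst m n * A j) (fun i => transferConst m n * B i) := by
  have : Nontrivial (Fin m ⊕ Fin n) :=
    ⟨⟨Sum.inl ⟨0, hm⟩, Sum.inr ⟨0, hn⟩, by simp⟩⟩
  obtain ⟨z, hz0, hz⟩ := exists_int_of_dual_vector (abs_det_approxMatrix Θ)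
    (c := Sum.elim A B) (sumElim_pos hA hB) (vecMul_approxMatrix Θ q p)
    (by
      intro h
      apply h0
      have hq0 : q = 0 := by
        ext i
        have := congrFun h (Sum.inr i)
        simpa using this
      have hp0 : p = 0 := by
        ext j
        have := congrFun h (Sum.inl j)
        simpa [hq0, Matrix.mulVec, dotProduct] using this
      rw [hq0, hp0]
      rfl)
    (by
      rw [prod_sumElim]
      rintro (j | i)
      · have := hp j
        rwa [abs_sub_comm] at this
      · exact hq i)
  refine boxSolution_of_approxMatrix hz0 fun k => ?_
  rw [← elim_transferConst]
  exact hz k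

/-- Transference to one linear form from two simultaneous approximations. -/
theorem boxSolution_row_of_pair {m : ℕ} (hm : 2 ≤ m) (Θ : Matrix (Fin 1) (Fin m) ℝ)
    {A : Fin m → ℝ} {δ : ℝ} (hA : ∀ j, 0 < A j) (hδ : 0 < δ)
    {q q' : ℤ} {p p' : Fin m → ℤ}
    (hmax : ∀ j, |Θ 0 j * q - p j| * A j ≤ |(q : ℝ)| * δ)
    (hw : ∀ j, |(q : ℝ) * (Θ 0 j * q' - p' j) - q' * (Θ 0 j * q - p j)| * A j ≤ ∏ j, A j)
    (hne : ∃ j, (q : ℝ) * (Θ 0 j * q' - p' j) - q' * (Θ 0 j * q - p j) ≠ 0) :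
    BoxSolution Θ 0 (fun j => transferConst m 1 * A j) (fun _ => transferConst m 1 * δ) := by
  have hmv : ∀ (q : ℤ) j, Θ.transpose.mulVec (fun i : Fin 1 => (((fun _ => q) i : ℤ) : ℝ)) j
      = Θ 0 j * q := by
    intro q j
    simp [Matrix.mulVec, dotProduct]
  have hP : ∏ k, Sum.elim A (fun _ : Fin 1 => δ) k = (∏ j, A j) * δ := by
    rw [prod_sumElim]; simp
  obtain ⟨z, hz0, hz⟩ := exists_int_of_dual_pair (by simp; omega) (abs_det_approxMatrix Θ)
    (c := Sum.elim A (fun _ : Fin 1 => δ)) (sumElim_pos hA fun _ => hδ)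
    (vecMul_approxMatrix Θ (fun _ => q) p) (vecMul_approxMatrix Θ (fun _ => q') p')
    -- The pivot is the coordinate q. Its bound δ appears on both sides of the minor condition, so
    -- it is absent from `hw`.
    (Sum.inr 0)
    (by
      rintro (j | i)
      · have := hmax j
        rw [abs_sub_comm] at this
        simpa only [Sum.elim_inl, Sum.elim_inr, hmv] using this
      · simp)
    (by
      rw [hP]
      rintro (j | i)
      · simp only [Sum.elim_inl, Sum.elim_inr, hmv]
        have e : (q : ℝ) * ((p' j : ℝ) - Θ 0 j * q') - q' * ((p j : ℝ) - Θ 0 j * q)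
          = -((q : ℝ) * (Θ 0 j * q' - p' j) - q' * (Θ 0 j * q - p j)) := by ring
        rw [e, abs_neg, ← mul_assoc]
        exact mul_le_mul_of_nonneg_right (hw j) hδ.le
      · simp only [Sum.elim_inr]
        rw [show (q : ℝ) * q' - q' * q = 0 by ring, abs_zero, zero_mul]
        exact mul_nonneg (Finset.prod_nonneg fun j _ => (hA j).le) hδ.le)
    (by
      obtain ⟨j, hj⟩ := hne
      refine ⟨Sum.inl j, ?_⟩
      simp only [Sum.elim_inl, Sum.elim_inr, hmv]
      intro h
      apply hj
      linarith)
  refine boxSolution_of_approxMatrix hz0 fun k => ?_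
  rw [← elim_transferConst]
  exact hz k

/-- Transference to simultaneous approximation from two values of one linear form. -/
theorem boxSolution_col_of_pair {m : ℕ} (hm : 2 ≤ m) (Θ : Matrix (Fin 1) (Fin m) ℝ)
    {δ : Fin m → ℝ} {Q : ℝ} (hδ : ∀ j, 0 < δ j) (hQ : 0 < Q)
    {x x' : Fin m → ℤ} {y y' : ℤ} {l l' : ℝ}
    (hl : l = Θ.mulVec (fun j => (x j : ℝ)) 0 - y)
    (hl' : l' = Θ.mulVec (fun j => (x' j : ℝ)) 0 - y')
    (hmax : ∀ j, |(x j : ℝ)| * δ j ≤ |l| * Q)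
    (hw : ∀ j, |l * x' j - l' * x j| * δ j ≤ ∏ j, δ j)
    (hne : ∃ j, l * x' j - l' * x j ≠ 0) :
    BoxSolution Θ.transpose 0 (fun _ => transferConst 1 m * Q)
      (fun j => transferConst 1 m * δ j) := by
  have hP : ∏ k, Sum.elim (fun _ : Fin 1 => Q) δ k = Q * ∏ j, δ j := by
    rw [prod_sumElim]; simp
  obtain ⟨z, hz0, hz⟩ := exists_int_of_dual_pair (by simp; omega)
    (abs_det_approxMatrix Θ.transpose)
    (c := Sum.elim (fun _ : Fin 1 => Q) δ) (sumElim_pos (fun _ => hQ) hδ)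
    (vecMul_approxMatrix Θ.transpose x (fun _ => y))
    (vecMul_approxMatrix Θ.transpose x' (fun _ => y'))
    -- The pivot is the coordinate −l, and its bound Q cancels from the minor condition.
    (Sum.inl 0)
    (by
      simp only [Matrix.transpose_transpose, Sum.elim_inl, ← neg_sub _ (y : ℝ), ← hl]
      rintro (j | i)
      · fin_cases j
        simp only [Sum.elim_inl, Fin.zero_eta, ← hl]
        exact le_refl _
      · rw [abs_neg]; exact hmax i)
    (by
      rw [hP]
      simp only [Matrix.transpose_transpose, Sum.elim_inl, ← neg_sub _ (y : ℝ),
        ← neg_sub _ (y' : ℝ), ← hl, ← hl']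
      rintro (j | i)
      · fin_cases j
        simp only [Sum.elim_inl, Fin.zero_eta, ← hl, ← hl']
        rw [show -l * -l' - -l' * -l = 0 by ring, abs_zero, zero_mul]
        exact mul_nonneg hQ.le (Finset.prod_nonneg fun j _ => (hδ j).le)
      · simp only [Sum.elim_inr]
        rw [show -l * (x' i : ℝ) - -l' * x i = -(l * x' i - l' * x i) by ring, abs_neg,
          ← mul_assoc, mul_comm Q]
        exact mul_le_mul_of_nonneg_right (hw i) hQ.le)
    (by
      obtain ⟨j, hj⟩ := hne
      refine ⟨Sum.inr j, ?_⟩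
      simp only [Matrix.transpose_transpose, Sum.elim_inl, Sum.elim_inr, ← neg_sub _ (y : ℝ),
        ← neg_sub _ (y' : ℝ), ← hl, ← hl']
      intro h
      apply hj
      linarith)
  refine boxSolution_of_approxMatrix hz0 fun k => ?_
  rw [← elim_transferConst]
  exact hz k

/-! ### Characters and powers of the Fejér kernel. -/

/-- The character `e(θ) = exp (2 π i θ)`. -/
noncomputable def expChar (θ : ℝ) : ℂ := Complex.exp ((2 * Real.pi * θ : ℝ) * Complex.I)

theorem expChar_add (a b : ℝ) : expChar (a + b) = expChar a * expChar b := by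
  rw [expChar, expChar, expChar, ← Complex.exp_add]
  congr 1
  push_cast
  ring

theorem expChar_zero : expChar 0 = 1 := by simp [expChar]

theorem norm_expChar (θ : ℝ) : ‖expChar θ‖ = 1 := Complex.norm_exp_ofReal_mul_I _

theorem expChar_int (k : ℤ) : expChar k = 1 := by
  rw [expChar, Complex.exp_eq_one_iff]
  exact ⟨k, by push_cast; ring⟩

theorem expChar_add_int (a : ℝ) (k : ℤ) : expChar (a + k) = expChar a := by
  rw [expChar_add, expChar_int, mul_one]

theorem expChar_sum {ι : Type*} (s : Finset ι) (f : ι → ℝ) :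
    expChar (∑ i ∈ s, f i) = ∏ i ∈ s, expChar (f i) := by
  classical
  induction s using Finset.induction_on with
  | empty => simp [expChar_zero]
  | insert a s ha ih => rw [Finset.sum_insert ha, Finset.prod_insert ha, expChar_add, ih]

theorem expChar_nat_mul (r : ℕ) (θ : ℝ) : expChar (r * θ) = expChar θ ^ r := by
  induction r with
  | zero => simp [expChar_zero]
  | succ r ih => rw [pow_succ, ← ih, ← expChar_add]; congr 1; push_cast; ring

/-- After reduction to |ψ| ≤ 1/2, |e(ψ) − 1| = 2|sin πψ| and Jordan's inequality applies. -/
theorem le_norm_expChar_sub_one (θ : ℝ) : 4 * |θ - round θ| ≤ ‖expChar θ - 1‖ := by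
  set ψ := θ - round θ with hψ
  have h1 : expChar θ = expChar ψ := by
    have : θ = ψ + (round θ : ℤ) := by rw [hψ]; ring
    conv_lhs => rw [this]
    rw [expChar_add_int]
  have habs : |ψ| ≤ 1 / 2 := abs_sub_round θ
  have hpi := Real.pi_pos
  have h2 : ‖expChar ψ - 1‖ = 2 * |Real.sin (Real.pi * ψ)| := by
    have := Complex.norm_exp_I_mul_ofReal_sub_one (2 * Real.pi * ψ)
    rw [expChar, mul_comm, this]
    rw [Real.norm_eq_abs, abs_mul, abs_of_pos (by norm_num : (0 : ℝ) < 2)]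
    congr 3
    ring
  have h3 : 2 / Real.pi * |Real.pi * ψ| ≤ |Real.sin (Real.pi * ψ)| := by
    apply Real.mul_abs_le_abs_sin
    rw [abs_mul, abs_of_pos hpi]
    nlinarith
  rw [abs_mul, abs_of_pos hpi] at h3
  have h4 : 2 / Real.pi * (Real.pi * |ψ|) = 2 * |ψ| := by field_simp
  rw [h1, h2]
  linarith

/-- The geometric sum is at most 2/|e(θ) − 1|, hence small compared with N when θ is at distance at
least M/N from the integers. -/
theorem norm_sum_expChar_le {N : ℕ} {θ M : ℝ}
    (h : ∀ v : ℤ, M ≤ |θ - v| * N) :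
    ‖∑ r : Fin N, expChar ((r : ℕ) * θ)‖ * M ≤ N := by
  have hr := h (round θ)
  have hlow := le_norm_expChar_sub_one θ
  have hgeom : (∑ r : Fin N, expChar ((r : ℕ) * θ)) * (expChar θ - 1) = expChar θ ^ N - 1 := by
    rw [Fin.sum_univ_eq_sum_range (fun r => expChar ((r : ℕ) * θ)) N,
      Finset.sum_congr rfl fun r _ => expChar_nat_mul r θ]
    exact geom_sum_mul _ _
  have hup : ‖∑ r : Fin N, expChar ((r : ℕ) * θ)‖ * ‖expChar θ - 1‖ ≤ 2 := by
    rw [← norm_mul, hgeom]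
    refine (norm_sub_le _ _).trans ?_
    rw [norm_pow, norm_expChar]
    norm_num
  set D := ‖∑ r : Fin N, expChar ((r : ℕ) * θ)‖
  have hD : 0 ≤ D := norm_nonneg _
  have hN : (0 : ℝ) ≤ N := Nat.cast_nonneg _
  have h1 : D * |θ - round θ| ≤ 1 := by
    have := mul_le_mul_of_nonneg_left hlow hD
    linarith
  calc D * M ≤ D * (|θ - round θ| * N) := mul_le_mul_of_nonneg_left hr hD
    _ = (D * |θ - round θ|) * N := by ring
    _ ≤ 1 * N := mul_le_mul_of_nonneg_right h1 hN
    _ = N := one_mul _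

/-- The index set of the expansion of the `k`-th power of a Fejér kernel of order `N`. -/
abbrev KernelIndex (k N : ℕ) : Type := (Fin k → Fin N) × (Fin k → Fin N)

/-- The frequency belonging to an index. -/
def kernelFreq {k N : ℕ} (b : KernelIndex k N) : ℤ :=
  ∑ i, ((b.1 i : ℕ) : ℤ) - ∑ i, ((b.2 i : ℕ) : ℤ)

theorem sum_index_bounds {k N : ℕ} (r : Fin k → Fin N) :
    0 ≤ ∑ i, ((r i : ℕ) : ℤ) ∧ ∑ i, ((r i : ℕ) : ℤ) ≤ (k * N : ℕ) := by
  refine ⟨Finset.sum_nonneg fun i _ => by positivity, ?_⟩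
  calc ∑ i, ((r i : ℕ) : ℤ) ≤ ∑ _i : Fin k, (N : ℤ) :=
        Finset.sum_le_sum fun i _ => by exact_mod_cast (r i).2.le
    _ = _ := by simp

theorem abs_kernelFreq_le {k N : ℕ} (b : KernelIndex k N) : |kernelFreq b| ≤ (k * N : ℕ) := by
  have h1 := sum_index_bounds b.1
  have h2 := sum_index_bounds b.2
  rw [kernelFreq, abs_le]
  constructor <;> linarith [h1.1, h1.2, h2.1, h2.2]

theorem card_kernelIndex (k N : ℕ) : (Fintype.card (KernelIndex k N) : ℝ) = (N : ℝ) ^ (2 * k) := by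
  simp [KernelIndex, Fintype.card_prod, two_mul, pow_add]

/-- The right side is the 2k-th power of the modulus of a Dirichlet sum, so a gain M in one such sum
becomes a gain M^(2k). -/
theorem sum_expChar_kernelFreq (k N : ℕ) (θ : ℝ) :
    ∑ b : KernelIndex k N, expChar (kernelFreq b * θ)
      = (∑ r : Fin N, expChar ((r : ℕ) * θ)) ^ k * (∑ r : Fin N, expChar ((r : ℕ) * -θ)) ^ k := by
  rw [Fintype.sum_pow, Fintype.sum_pow, Finset.sum_mul_sum, Fintype.sum_prod_type]
  refine Finset.sum_congr rfl fun a _ => Finset.sum_congr rfl fun b _ => ?_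
  rw [← expChar_sum, ← expChar_sum, ← expChar_add]
  congr 1
  rw [kernelFreq]
  push_cast
  rw [sub_mul, Finset.sum_mul, Finset.sum_mul, sub_eq_add_neg, ← Finset.sum_neg_distrib]
  simp

theorem norm_sum_expChar_kernelFreq_le {k N : ℕ} {θ M : ℝ} (hM : 0 < M)
    (h : ∀ v : ℤ, M ≤ |θ - v| * N) :
    ‖∑ b : KernelIndex k N, expChar (kernelFreq b * θ)‖ * M ^ (2 * k)
      ≤ Fintype.card (KernelIndex k N) := by
  have h1 := norm_sum_expChar_le h
  have h2 := norm_sum_expChar_le (θ := -θ) (N := N) (fun v => by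
    have := h (-v)
    push_cast at this
    rw [show -θ - (v : ℝ) = -(θ - -v) by ring, abs_neg]
    exact this)
  rw [card_kernelIndex, sum_expChar_kernelFreq, norm_mul, norm_pow, norm_pow]
  calc ‖∑ r : Fin N, expChar ((r : ℕ) * θ)‖ ^ k * ‖∑ r : Fin N, expChar ((r : ℕ) * -θ)‖ ^ k
        * M ^ (2 * k)
      = (‖∑ r : Fin N, expChar ((r : ℕ) * θ)‖ * M) ^ k
        * (‖∑ r : Fin N, expChar ((r : ℕ) * -θ)‖ * M) ^ k := by
        rw [mul_pow, mul_pow, two_mul, pow_add]; ring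
    _ ≤ (N : ℝ) ^ k * (N : ℝ) ^ k := by gcongr
    _ = _ := by rw [two_mul, pow_add]

theorem norm_sum_expChar_le_card {ι : Type*} [Fintype ι] (f : ι → ℝ) :
    ‖∑ b, expChar (f b)‖ ≤ Fintype.card ι := by
  refine (norm_sum_le _ _).trans ?_
  simp [norm_expChar]

/-- The constant term of the kernel is not small. -/
theorem card_kernelIndex_le (k N : ℕ) :
    Fintype.card (KernelIndex k N) ≤
      (k * N + 1) ^ 2 * Fintype.card {b : KernelIndex k N // kernelFreq b = 0} := by
  classical
  set S : (Fin k → Fin N) → ℕ := fun r => ∑ i, (r i : ℕ) with hS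
  have hmap : ∀ r ∈ (Finset.univ : Finset (Fin k → Fin N)), S r ∈ Finset.range (k * N + 1) := by
    intro r _
    rw [Finset.mem_range, Nat.lt_succ_iff]
    have := (sum_index_bounds r).2
    exact_mod_cast this
  -- Pigeonhole: the k-fold sums take at most kN + 1 values, so some fibre has at least N^k/(kN + 1)
  -- tuples, and any pair from that fibre has frequency 0.
  obtain ⟨y, -, hy⟩ := Finset.exists_le_card_fiber_of_nsmul_le_card_of_maps_to
    (M := ℚ) (b := (N : ℚ) ^ k / (k * N + 1)) hmap (by simp) (by
      simp only [Finset.card_range, nsmul_eq_mul, Finset.card_univ, Fintype.card_fun,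
        Fintype.card_fin]
      push_cast
      apply le_of_eq
      field_simp)
  set F := Finset.univ.filter fun r => S r = y
  have hcard : F.card ^ 2 ≤ Fintype.card {b : KernelIndex k N // kernelFreq b = 0} := by
    rw [Fintype.card_subtype, sq, ← Finset.card_product]
    apply Finset.card_le_card
    intro b hb
    rw [Finset.mem_product] at hb
    simp only [F, Finset.mem_filter, Finset.mem_univ, true_and] at hb ⊢
    have h1 : S b.1 = S b.2 := hb.1.trans hb.2.symm
    rw [kernelFreq, sub_eq_zero]
    exact_mod_cast h1
  have h2 : (N : ℚ) ^ k ≤ (k * N + 1) * F.card := by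
    rw [div_le_iff₀ (by positivity)] at hy
    linarith
  have h3 : N ^ k ≤ (k * N + 1) * F.card := by exact_mod_cast h2
  calc Fintype.card (KernelIndex k N) = (N ^ k) ^ 2 := by
        simp [KernelIndex, Fintype.card_prod, sq]
    _ ≤ ((k * N + 1) * F.card) ^ 2 := Nat.pow_le_pow_left h3 2
    _ = (k * N + 1) ^ 2 * F.card ^ 2 := by ring
    _ ≤ _ := Nat.mul_le_mul_left _ hcard

/-! ### The quantitative Kronecker theorem. -/

/-- Quantitative Kronecker theorem: if the transposed homogeneous system has no solution, then
the inhomogeneous one has. -/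
theorem exists_inhomogeneous_solution {m n : ℕ} (Θ : Matrix (Fin n) (Fin m) ℝ) (η : Fin n → ℝ)
    (k : ℕ) (X : Fin m → ℕ) (N : Fin n → ℕ) (hX : ∀ j, 0 < X j) (hN : ∀ i, 0 < N i)
    {M : ℝ} (hM : 1 ≤ M)
    (hhom : ∀ u : Fin n → ℤ, u ≠ 0 → (∀ i, |u i| ≤ (k * N i : ℕ)) →
      ∃ j, ∀ v : ℤ, M ≤ |Θ.transpose.mulVec (fun i => (u i : ℝ)) j - v| * X j)
    (hk : 2 * ∏ i, ((k * N i + 1 : ℕ) : ℝ) ^ 2 < M ^ (2 * k)) :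
    ∃ (x : Fin m → ℤ) (y : Fin n → ℤ), (∀ j, |x j| ≤ (k * X j : ℕ)) ∧
      ∀ i, |Θ.mulVec (fun j => (x j : ℝ)) i - y i - η i| * N i < M := by
  classical
  by_contra hcon
  push Not at hcon
  have hM0 : 0 < M := by linarith
  have hMk : 0 < M ^ (2 * k) := by positivity
  let 𝒜 := (j : Fin m) → KernelIndex k (X j)
  let ℬ := (i : Fin n) → KernelIndex k (N i)
  let x : 𝒜 → Fin m → ℤ := fun a j => kernelFreq (a j)
  let u : ℬ → Fin n → ℤ := fun b i => kernelFreq (b i)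
  let F : 𝒜 → ℬ → ℂ := fun a b =>
    expChar (∑ i, (u b i : ℝ) * (Θ.mulVec (fun j => (x a j : ℝ)) i - η i))
  have hA : (Fintype.card 𝒜 : ℝ) = ∏ j, (Fintype.card (KernelIndex k (X j)) : ℝ) := by
    rw [Fintype.card_pi]; push_cast; rfl
  have hB : (Fintype.card ℬ : ℝ) = ∏ i, (Fintype.card (KernelIndex k (N i)) : ℝ) := by
    rw [Fintype.card_pi]; push_cast; rfl
  have hApos : (0 : ℝ) < Fintype.card 𝒜 := by
    rw [hA]
    refine Finset.prod_pos fun j _ => ?_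
    rw [card_kernelIndex]
    have : (0 : ℝ) < X j := by exact_mod_cast hX j
    positivity
  have hBpos : (0 : ℝ) < Fintype.card ℬ := by
    rw [hB]
    refine Finset.prod_pos fun j _ => ?_
    rw [card_kernelIndex]
    have : (0 : ℝ) < N j := by exact_mod_cast hN j
    positivity
  have hprod : ∀ {l : ℕ} (Y : Fin l → ℕ) (θ : Fin l → ℝ) (j : Fin l),
      (∀ v : ℤ, M ≤ |θ j - v| * Y j) →
      ‖∏ j, ∑ b : KernelIndex k (Y j), expChar (kernelFreq b * θ j)‖ * M ^ (2 * k)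
        ≤ ∏ j, (Fintype.card (KernelIndex k (Y j)) : ℝ) := by
    intro l Y θ j hj
    rw [norm_prod, ← Finset.mul_prod_erase _ _ (Finset.mem_univ j),
      ← Finset.mul_prod_erase _ (fun j => (Fintype.card (KernelIndex k (Y j)) : ℝ))
        (Finset.mem_univ j), mul_right_comm]
    refine mul_le_mul (norm_sum_expChar_kernelFreq_le hM0 hj) ?_
      (Finset.prod_nonneg fun _ _ => norm_nonneg _) (Nat.cast_nonneg _)
    exact Finset.prod_le_prod (fun _ _ => norm_nonneg _)
      fun i _ => norm_sum_expChar_le_card _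
  have hrow : ∀ a, ‖∑ b, F a b‖ * M ^ (2 * k) ≤ Fintype.card ℬ := by
    intro a
    have hxa : ∀ j, |x a j| ≤ (k * X j : ℕ) := fun j => abs_kernelFreq_le _
    have e : ∑ b, F a b = ∏ i, ∑ b : KernelIndex k (N i),
        expChar (kernelFreq b * (Θ.mulVec (fun j => (x a j : ℝ)) i - η i)) := by
      rw [Fintype.prod_sum]
      exact Finset.sum_congr rfl fun b _ => expChar_sum _ _
    -- Otherwise the nearby integers, one for each coordinate, would form a y contradicting `hcon`.
    have hy : ∃ i, ∀ v : ℤ, M ≤ |Θ.mulVec (fun j => (x a j : ℝ)) i - η i - v| * N i := by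
      by_contra hno
      push Not at hno
      choose y hy using hno
      obtain ⟨i, hi⟩ := hcon (x a) y hxa
      have := hy i
      rw [sub_right_comm] at this
      linarith
    obtain ⟨i, hi⟩ := hy
    rw [e, hB]
    exact hprod N _ i hi
  have hcol : ∀ b, ∑ a, F a b = expChar (-∑ i, (u b i : ℝ) * η i) *
      ∏ j, ∑ a : KernelIndex k (X j),
        expChar (kernelFreq a * Θ.transpose.mulVec (fun i => (u b i : ℝ)) j) := by
    intro b
    rw [Fintype.prod_sum, Finset.mul_sum]
    refine Finset.sum_congr rfl fun a _ => ?_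
    rw [← expChar_sum, ← expChar_add]
    change expChar _ = expChar _
    congr 1
    have h1 : ∑ i, (u b i : ℝ) * Θ.mulVec (fun j => (x a j : ℝ)) i
        = ∑ j, (x a j : ℝ) * Θ.transpose.mulVec (fun i => (u b i : ℝ)) j := by
      simp only [Matrix.mulVec, dotProduct, Matrix.transpose_apply, Finset.mul_sum]
      rw [Finset.sum_comm]
      refine Finset.sum_congr rfl fun j _ => Finset.sum_congr rfl fun i _ => by ring
    simp only [mul_sub, Finset.sum_sub_distrib]
    rw [h1]
    ring
  have hcol0 : ∀ b, u b = 0 → ∑ a, F a b = Fintype.card 𝒜 := by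
    intro b hb
    simp only [F, hb]
    simp [expChar_zero]
  have hcol1 : ∀ b, u b ≠ 0 → ‖∑ a, F a b‖ * M ^ (2 * k) ≤ Fintype.card 𝒜 := by
    intro b hb
    obtain ⟨j, hj⟩ := hhom (u b) hb fun i => abs_kernelFreq_le _
    rw [hcol, norm_mul, norm_expChar, one_mul, hA]
    exact hprod X _ j hj
  -- The indices of frequency zero. Each contributes the full count |𝒜|, while the rows and the
  -- other columns contribute at most |𝒜||ℬ|/M^(2k) each in total.
  set Z := Finset.univ.filter fun b : ℬ => u b = 0 with hZ
  have hswap : ∑ a, ∑ b, F a b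
      = (Z.card : ℂ) * Fintype.card 𝒜 + ∑ b ∈ Finset.univ.filter (fun b : ℬ => ¬ u b = 0),
        ∑ a, F a b := by
    rw [Finset.sum_comm, ← Finset.sum_filter_add_sum_filter_not Finset.univ (fun b : ℬ => u b = 0)]
    congr 1
    rw [Finset.sum_congr rfl fun b hb => hcol0 b (Finset.mem_filter.1 hb).2]
    simp [hZ]
  have hmain : (Z.card : ℝ) * Fintype.card 𝒜
      ≤ ‖∑ a, ∑ b, F a b‖ + ‖∑ b ∈ Finset.univ.filter (fun b : ℬ => ¬ u b = 0), ∑ a, F a b‖ := by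
    have : (Z.card : ℂ) * Fintype.card 𝒜 = ∑ a, ∑ b, F a b
      - ∑ b ∈ Finset.univ.filter (fun b : ℬ => ¬ u b = 0), ∑ a, F a b := by rw [hswap]; ring
    calc (Z.card : ℝ) * Fintype.card 𝒜 = ‖(Z.card : ℂ) * Fintype.card 𝒜‖ := by simp
      _ ≤ _ := by rw [this]; exact norm_sub_le _ _
  have hb1 : ‖∑ a, ∑ b, F a b‖ * M ^ (2 * k) ≤ Fintype.card 𝒜 * Fintype.card ℬ := by
    calc ‖∑ a, ∑ b, F a b‖ * M ^ (2 * k) ≤ (∑ a, ‖∑ b, F a b‖) * M ^ (2 * k) :=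
          mul_le_mul_of_nonneg_right (norm_sum_le _ _) hMk.le
      _ = ∑ a, ‖∑ b, F a b‖ * M ^ (2 * k) := Finset.sum_mul _ _ _
      _ ≤ ∑ _a : 𝒜, (Fintype.card ℬ : ℝ) := Finset.sum_le_sum fun a _ => hrow a
      _ = _ := by simp
  have hb2 : ‖∑ b ∈ Finset.univ.filter (fun b : ℬ => ¬ u b = 0), ∑ a, F a b‖ * M ^ (2 * k)
      ≤ Fintype.card 𝒜 * Fintype.card ℬ := by
    calc ‖∑ b ∈ Finset.univ.filter (fun b : ℬ => ¬ u b = 0), ∑ a, F a b‖ * M ^ (2 * k)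
        ≤ (∑ b ∈ Finset.univ.filter (fun b : ℬ => ¬ u b = 0), ‖∑ a, F a b‖) * M ^ (2 * k) :=
          mul_le_mul_of_nonneg_right (norm_sum_le _ _) hMk.le
      _ = ∑ b ∈ Finset.univ.filter (fun b : ℬ => ¬ u b = 0), ‖∑ a, F a b‖ * M ^ (2 * k) :=
          Finset.sum_mul _ _ _
      _ ≤ ∑ _b ∈ Finset.univ.filter (fun b : ℬ => ¬ u b = 0), (Fintype.card 𝒜 : ℝ) :=
          Finset.sum_le_sum fun b hb => hcol1 b (Finset.mem_filter.1 hb).2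
      _ ≤ ∑ _b : ℬ, (Fintype.card 𝒜 : ℝ) :=
          Finset.sum_le_sum_of_subset_of_nonneg (Finset.filter_subset _ _)
            fun _ _ _ => Nat.cast_nonneg _
      _ = _ := by simp [mul_comm]
  have hZcard : (Fintype.card ℬ : ℝ) ≤ (∏ i, ((k * N i + 1 : ℕ) : ℝ) ^ 2) * Z.card := by
    have e : Z.card = ∏ i, Fintype.card {b : KernelIndex k (N i) // kernelFreq b = 0} := by
      have : Z = Fintype.piFinset fun i =>
          Finset.univ.filter fun b : KernelIndex k (N i) => kernelFreq b = 0 := by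
        ext b
        exact Iff.trans (by simp [hZ, funext_iff, u]) Fintype.mem_piFinset.symm
      rw [this, Fintype.card_piFinset]
      exact Finset.prod_congr rfl fun i _ => (Fintype.card_subtype _).symm
    rw [hB, e]
    push_cast
    rw [← Finset.prod_mul_distrib]
    refine Finset.prod_le_prod (fun i _ => Nat.cast_nonneg _) fun i _ => ?_
    exact_mod_cast card_kernelIndex_le k (N i)
  set R := ∏ i, ((k * N i + 1 : ℕ) : ℝ) ^ 2 with hR
  have hRpos : 0 ≤ R := Finset.prod_nonneg fun i _ => by positivity
  have h1 : (Z.card : ℝ) * Fintype.card 𝒜 * M ^ (2 * k)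
      ≤ 2 * (Fintype.card 𝒜 * Fintype.card ℬ) := by
    have := mul_le_mul_of_nonneg_right hmain hMk.le
    linarith
  have h2 : (Z.card : ℝ) * M ^ (2 * k) ≤ 2 * Fintype.card ℬ := by
    refine le_of_mul_le_mul_left ?_ hApos
    linarith
  have hZpos : (0 : ℝ) < Z.card := by
    rcases (Nat.cast_nonneg (α := ℝ) Z.card).eq_or_lt with h | h
    · rw [← h] at hZcard; linarith
    · exact h
  nlinarith

/-! ### Exponents expressed through boxes. -/

theorem weightedNorm_le_iff {k : ℕ} {w : Fin k → ℝ} (hw : ∀ i, 0 < w i) {v : Fin k → ℝ} {t : ℝ}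
    (ht : 0 < t) : weightedNorm w v ≤ t ↔ ∀ i, |v i| ≤ t ^ w i := by
  have h1 : ∀ i, |v i| ^ (1 / w i) ≤ t ↔ |v i| ≤ t ^ w i := by
    intro i
    rw [one_div, Real.rpow_inv_le_iff_of_pos (abs_nonneg _) ht.le (hw i)]
  rw [weightedNorm]
  constructor
  · intro h i
    exact (h1 i).1 ((le_ciSup (Set.finite_range _).bddAbove i).trans h)
  · intro h
    exact Real.iSup_le (fun i => (h1 i).2 (h i)) ht.le

theorem hasNonzeroSolution_iff {m n : ℕ} {σ : Fin m → ℝ} {ρ : Fin n → ℝ} (hσ : ∀ j, 0 < σ j)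
    (hρ : ∀ i, 0 < ρ i) {Θ : Matrix (Fin n) (Fin m) ℝ} {η : Fin n → ℝ} {γ t : ℝ} (ht : 0 < t) :
    HasNonzeroSolution σ ρ Θ η γ t ↔
      BoxSolution Θ η (fun j => t ^ σ j) (fun i => t ^ (-γ * ρ i)) := by
  rw [HasNonzeroSolution, BoxSolution]
  refine exists_congr fun x => exists_congr fun y => and_congr_right fun _ => ?_
  rw [weightedNorm_le_iff hσ ht, weightedNorm_le_iff hρ (Real.rpow_pos_of_pos ht _)]
  simp only [Real.rpow_mul ht.le]

theorem HasNonzeroSolution.anti {m n : ℕ} {σ : Fin m → ℝ} {ρ : Fin n → ℝ}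
    {Θ : Matrix (Fin n) (Fin m) ℝ} {η : Fin n → ℝ} {γ γ' t : ℝ} (ht : 1 ≤ t) (hγ : γ' ≤ γ)
    (h : HasNonzeroSolution σ ρ Θ η γ t) : HasNonzeroSolution σ ρ Θ η γ' t := by
  obtain ⟨x, y, h0, h1, h2⟩ := h
  exact ⟨x, y, h0, h1, h2.trans (Real.rpow_le_rpow_of_exponent_le ht (by linarith))⟩

section Exponents

variable {m n : ℕ} {σ : Fin m → ℝ} {ρ : Fin n → ℝ} {Θ : Matrix (Fin n) (Fin m) ℝ}
  {η : Fin n → ℝ} {γ : ℝ}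

theorem le_inhomExponent (h : ∀ T : ℝ, ∃ t : ℝ, T ≤ t ∧ HasNonzeroSolution σ ρ Θ η γ t) :
    (γ : EReal) ≤ inhomExponent σ ρ Θ η :=
  le_sSup ⟨γ, rfl, h⟩

theorem le_inhomUniformExponent (h : ∃ T : ℝ, ∀ t : ℝ, T ≤ t → HasNonzeroSolution σ ρ Θ η γ t) :
    (γ : EReal) ≤ inhomUniformExponent σ ρ Θ η :=
  le_sSup ⟨γ, rfl, h⟩

theorem frequently_of_lt_inhomExponent (h : (γ : EReal) < inhomExponent σ ρ Θ η) (T : ℝ) :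
    ∃ t : ℝ, T ≤ t ∧ HasNonzeroSolution σ ρ Θ η γ t := by
  obtain ⟨_, ⟨γ', rfl, hγ'⟩, hlt⟩ := lt_sSup_iff.1 h
  obtain ⟨t, ht, hs⟩ := hγ' (max T 1)
  exact ⟨t, (le_max_left _ _).trans ht,
    hs.anti ((le_max_right _ _).trans ht) (EReal.coe_lt_coe_iff.1 hlt).le⟩

theorem eventually_of_lt_inhomUniformExponent (h : (γ : EReal) < inhomUniformExponent σ ρ Θ η) :
    ∃ T : ℝ, ∀ t : ℝ, T ≤ t → HasNonzeroSolution σ ρ Θ η γ t := by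
  obtain ⟨_, ⟨γ', rfl, T, hγ'⟩, hlt⟩ := lt_sSup_iff.1 h
  exact ⟨max T 1, fun t ht => (hγ' t ((le_max_left _ _).trans ht)).anti
    ((le_max_right _ _).trans ht) (EReal.coe_lt_coe_iff.1 hlt).le⟩

theorem inhomUniformExponent_le_inhomExponent :
    inhomUniformExponent σ ρ Θ η ≤ inhomExponent σ ρ Θ η := by
  refine sSup_le_sSup ?_
  rintro _ ⟨γ, rfl, T, h⟩
  exact ⟨γ, rfl, fun T' => ⟨max T T', le_max_right _ _, h _ (le_max_left _ _)⟩⟩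

end Exponents

theorem coe_le_of_forall_lt {a : ℝ} {b : EReal} (h : ∀ g : ℝ, g < a → (g : EReal) ≤ b) :
    (a : EReal) ≤ b := by
  refine le_of_forall_lt fun c hc => ?_
  obtain ⟨g, hcg, hga⟩ := EReal.lt_iff_exists_real_btwn.1 hc
  exact hcg.trans_le (h g (EReal.coe_lt_coe_iff.1 hga))

theorem coe_le_of_forall_Ioo_lt {a₀ a : ℝ} (ha : a₀ < a) {b : EReal}
    (h : ∀ g : ℝ, a₀ < g → g < a → (g : EReal) ≤ b) : (a : EReal) ≤ b := by
  refine coe_le_of_forall_lt fun g hg => ?_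
  obtain ⟨g', h1, h2⟩ := exists_between (max_lt ha hg)
  refine le_trans ?_ (h g' ((le_max_left _ _).trans_lt h1) h2)
  exact_mod_cast ((le_max_right _ _).trans_lt h1).le

theorem prod_rpow_weight {k : ℕ} {w : Fin k → ℝ} (hw : ∑ i, w i = 1) {t : ℝ} (ht : 0 < t)
    (c : ℝ) : ∏ i, t ^ (c * w i) = t ^ c := by
  rw [← Real.rpow_sum_of_pos ht, ← Finset.mul_sum, hw, mul_one]

/-- For g < 1 the box has volume t^(1 − g) > 1 up to the usual power of 2, so Minkowski's theorem
applies. -/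
theorem one_le_weightedUniformExponent {m n : ℕ} {σ : Fin m → ℝ} {ρ : Fin n → ℝ}
    (hσ : IsWeight σ) (hρ : IsWeight ρ) (Θ : Matrix (Fin n) (Fin m) ℝ) :
    1 ≤ weightedUniformExponent σ ρ Θ := by
  refine coe_le_of_forall_lt fun g hg => le_inhomUniformExponent ⟨2, fun t ht => ?_⟩
  have ht0 : 0 < t := by linarith
  rw [hasNonzeroSolution_iff hσ.pos hρ.pos ht0]
  refine boxSolution_of_one_lt_prod Θ (fun j => Real.rpow_pos_of_pos ht0 _)
    (fun i => Real.rpow_pos_of_pos ht0 _) ?_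
  have h1 : ∏ j, t ^ σ j = t ^ (1 : ℝ) := by
    simpa using prod_rpow_weight hσ.sum_eq_one ht0 1
  rw [h1, prod_rpow_weight hρ.sum_eq_one ht0, ← Real.rpow_add ht0]
  exact Real.one_lt_rpow (by linarith) (by linarith)

theorem one_le_weightedExponent {m n : ℕ} {σ : Fin m → ℝ} {ρ : Fin n → ℝ}
    (hσ : IsWeight σ) (hρ : IsWeight ρ) (Θ : Matrix (Fin n) (Fin m) ℝ) :
    1 ≤ weightedExponent σ ρ Θ :=
  (one_le_weightedUniformExponent hσ hρ Θ).trans inhomUniformExponent_le_inhomExponent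

theorem eventually_le_rpow {ε : ℝ} (hε : 0 < ε) (C : ℝ) :
    ∀ᶠ t : ℝ in Filter.atTop, C ≤ t ^ ε :=
  (tendsto_rpow_atTop hε).eventually_ge_atTop C

theorem exists_pos_le_of_forall_pos {k : ℕ} {w : Fin k → ℝ} (hw : ∀ i, 0 < w i) :
    ∃ ε > 0, ∀ i, ε ≤ w i := by
  rcases Nat.eq_zero_or_pos k with rfl | hk
  · exact ⟨1, one_pos, fun i => i.elim0⟩
  · have : Nonempty (Fin k) := ⟨⟨0, hk⟩⟩
    obtain ⟨i, hi⟩ := Finite.exists_min w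
    exact ⟨w i, hw i, hi⟩

/-! ### Inhomogeneous exponents and exponents of the transpose. -/

/-- This is Kronecker's theorem with M = t^ε, X_j ≈ t^(γσ_j + ε) and N_i ≈ t^(ρ_i)/k. Since gγ < 1,
there is room between the exponents to absorb k and all powers of M. -/
theorem exists_solution_of_not_transpose {m n : ℕ} {σ : Fin m → ℝ} {ρ : Fin n → ℝ}
    (hσ : IsWeight σ) (hρ : IsWeight ρ) (Θ : Matrix (Fin n) (Fin m) ℝ) {η : Fin n → ℝ}
    (hη : η ≠ 0) {γ g : ℝ} (hγ : 0 < γ) (hg : 0 < g) (hgγ : g * γ < 1) :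
    ∃ a : ℝ, 0 < a ∧ ∀ᶠ t : ℝ in Filter.atTop, ¬ HasNonzeroSolution ρ σ Θ.transpose 0 γ t →
      HasNonzeroSolution σ ρ Θ η g (t ^ a) := by
  -- At height t the error is to be t^(−bρ_i) with b < 1 and the size of x is to be t^(aσ_j) with a
  -- > γ. At height t^a this is exponent g, because ag = b.
  set b := (1 + g * γ) / 2 with hb
  have hb1 : b < 1 := by rw [hb]; linarith
  have hbg : g * γ < b := by rw [hb]; linarith
  have hb0 : 0 < b := by rw [hb]; positivity
  set a := b / g with ha
  have ha0 : 0 < a := by positivity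
  have hag : a * g = b := by rw [ha]; field_simp
  have haγ : γ < a := by rw [ha, lt_div_iff₀ hg]; linarith
  obtain ⟨ε₁, hε₁, h1⟩ := exists_pos_le_of_forall_pos hσ.pos
  obtain ⟨ε₂, hε₂, h2⟩ := exists_pos_le_of_forall_pos hρ.pos
  obtain ⟨ε, hε, hεlt⟩ : ∃ ε > 0, ε < min ((a - γ) * ε₁ / 2) ((1 - b) * ε₂ / 2) := by
    apply exists_between
    have := sub_pos.2 haγ
    have := sub_pos.2 hb1
    apply lt_min <;> positivity
  have hεσ : ∀ j, γ * σ j + 2 * ε ≤ a * σ j := by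
    intro j
    have h3 := hεlt.trans_le (min_le_left _ _)
    have := mul_le_mul_of_nonneg_left (h1 j) (sub_pos.2 haγ).le
    linarith
  have hερ : ∀ i, 2 * ε - ρ i ≤ -b * ρ i := by
    intro i
    have h3 := hεlt.trans_le (min_le_right _ _)
    have := mul_le_mul_of_nonneg_left (h2 i) (sub_pos.2 hb1).le
    linarith
  -- The product in Kronecker's condition is at most 4^n t², so M^(2k) ≥ t³ is enough for large t.
  obtain ⟨k, hk⟩ := exists_nat_gt (3 / (2 * ε))
  have hk0 : (0 : ℝ) < k := lt_trans (by positivity) hk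
  have hk3 : 3 < 2 * k * ε := by
    rw [div_lt_iff₀ (by positivity)] at hk
    linarith
  obtain ⟨i₀, hi₀⟩ := Function.ne_iff.1 hη
  have hη0 : 0 < |η i₀| := abs_pos.2 hi₀
  refine ⟨a, ha0, ?_⟩
  filter_upwards [eventually_le_rpow hε (2 * k), eventually_le_rpow hε₂ (2 * k),
    Filter.eventually_ge_atTop 1, Filter.eventually_gt_atTop (2 * 4 ^ n),
    (tendsto_rpow_atTop (mul_pos hb0 (hρ.pos i₀))).eventually_gt_atTop (|η i₀|⁻¹)]
    with t ht1 ht2 ht ht4 ht5 hno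
  have ht0 : 0 < t := by linarith
  rw [hasNonzeroSolution_iff hρ.pos hσ.pos ht0] at hno
  rw [hasNonzeroSolution_iff hσ.pos hρ.pos (Real.rpow_pos_of_pos ht0 _)]
  set M := t ^ ε with hM
  have hM1 : 1 ≤ M := Real.one_le_rpow ht hε.le
  have hM0 : 0 < M := by linarith
  set X : Fin m → ℕ := fun j => ⌈M * t ^ (γ * σ j)⌉₊ with hX
  set N : Fin n → ℕ := fun i => ⌊t ^ ρ i / k⌋₊ with hN
  have htγ : ∀ j, 0 < t ^ (γ * σ j) := fun j => Real.rpow_pos_of_pos ht0 _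
  have hXge : ∀ j, M * t ^ (γ * σ j) ≤ X j := fun j => Nat.le_ceil _
  have hX0 : ∀ j, 0 < X j := fun j => Nat.ceil_pos.2 (mul_pos hM0 (htγ j))
  have hρ2 : ∀ i, 2 * k ≤ t ^ ρ i := fun i =>
    ht2.trans (Real.rpow_le_rpow_of_exponent_le ht (h2 i))
  have hN2 : ∀ i, 2 ≤ t ^ ρ i / k := fun i => by
    rw [le_div_iff₀ hk0]; exact hρ2 i
  have hN0 : ∀ i, 0 < N i := fun i => Nat.floor_pos.2 (by linarith [hN2 i])
  have hNle : ∀ i, (k : ℝ) * N i ≤ t ^ ρ i := fun i => by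
    have := Nat.floor_le (show 0 ≤ t ^ ρ i / k by linarith [hN2 i])
    rw [le_div_iff₀ hk0] at this
    linarith
  have hNge : ∀ i, t ^ ρ i ≤ 2 * k * N i := fun i => by
    have h3 := Nat.lt_floor_add_one (t ^ ρ i / k)
    have h4 : t ^ ρ i / k ≤ 2 * N i := by
      have : t ^ ρ i / k < N i + 1 := h3
      linarith [hN2 i]
    rw [div_le_iff₀ hk0] at h4
    linarith
  obtain ⟨x, y, hx, hy⟩ := exists_inhomogeneous_solution Θ η k X N hX0 hN0 hM1
    (by
      intro u hu0 hu
      by_contra hcon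
      push Not at hcon
      choose v hv using hcon
      refine hno ⟨u, v, fun h => hu0 (congrArg Prod.fst h), fun i => ?_, fun j => ?_⟩
      · have h3 : ((|u i| : ℤ) : ℝ) ≤ ((k * N i : ℕ) : ℤ) := by exact_mod_cast hu i
        push_cast at h3
        exact h3.trans (hNle i)
      · beta_reduce
        rw [Pi.zero_apply, sub_zero, neg_mul, Real.rpow_neg ht0.le, ← one_div,
          le_div_iff₀ (htγ j)]
        have h3 := mul_le_mul_of_nonneg_left (hXge j)
          (abs_nonneg (Θ.transpose.mulVec (fun i => (u i : ℝ)) j - v j))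
        have h4 := hv j
        have h5 : |Θ.transpose.mulVec (fun i => (u i : ℝ)) j - v j| * t ^ (γ * σ j) * M
          ≤ 1 * M := by linarith
        exact le_of_mul_le_mul_right h5 hM0)
    (by
      have h3 : ∏ i, ((k * N i + 1 : ℕ) : ℝ) ^ 2 ≤ ∏ i, (4 * t ^ (2 * ρ i)) := by
        refine Finset.prod_le_prod (fun i _ => by positivity) fun i _ => ?_
        have h4 : ((k * N i + 1 : ℕ) : ℝ) ≤ 2 * t ^ ρ i := by
          push_cast
          have := hNle i
          have : 1 ≤ t ^ ρ i := Real.one_le_rpow ht (hρ.pos i).le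
          linarith
        calc ((k * N i + 1 : ℕ) : ℝ) ^ 2 ≤ (2 * t ^ ρ i) ^ 2 := by gcongr
          _ = 4 * t ^ (2 * ρ i) := by
            rw [mul_pow, two_mul, Real.rpow_add ht0]; ring
      rw [Finset.prod_mul_distrib, prod_rpow_weight hρ.sum_eq_one ht0, Finset.prod_const,
        Finset.card_univ, Fintype.card_fin] at h3
      have h4 : M ^ (2 * k) = t ^ (2 * k * ε) := by
        rw [hM, ← Real.rpow_natCast, ← Real.rpow_mul ht0.le]
        congr 1
        push_cast
        ring
      have h5 : t ^ (3 : ℝ) ≤ t ^ (2 * k * ε) := Real.rpow_le_rpow_of_exponent_le ht hk3.le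
      have h6 : t ^ (3 : ℝ) = t * t ^ (2 : ℝ) := by
        rw [show (3 : ℝ) = 1 + 2 by norm_num, Real.rpow_add ht0, Real.rpow_one]
      have h7 : 0 < t ^ (2 : ℝ) := Real.rpow_pos_of_pos ht0 _
      rw [h4]
      calc 2 * ∏ i, ((k * N i + 1 : ℕ) : ℝ) ^ 2 ≤ 2 * (4 ^ n * t ^ (2 : ℝ)) := by linarith
        _ = (2 * 4 ^ n) * t ^ (2 : ℝ) := by ring
        _ < t * t ^ (2 : ℝ) := mul_lt_mul_of_pos_right ht4 h7
        _ ≤ _ := by rw [← h6]; exact h5)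
  have herr : ∀ i, |Θ.mulVec (fun j => (x j : ℝ)) i - y i - η i| ≤ t ^ (-b * ρ i) := by
    intro i
    have hρi : 0 < t ^ ρ i := Real.rpow_pos_of_pos ht0 _
    set D := |Θ.mulVec (fun j => (x j : ℝ)) i - y i - η i|
    have hD : 0 ≤ D := abs_nonneg _
    have h3 : D * t ^ ρ i ≤ M * M := by
      calc D * t ^ ρ i ≤ D * (2 * k * N i) := mul_le_mul_of_nonneg_left (hNge i) hD
        _ = 2 * k * (D * N i) := by ring
        _ ≤ 2 * k * M := mul_le_mul_of_nonneg_left (hy i).le (by positivity)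
        _ ≤ M * M := mul_le_mul_of_nonneg_right ht1 hM0.le
    calc D ≤ M * M / t ^ ρ i := by rwa [le_div_iff₀ hρi]
      _ = t ^ (2 * ε - ρ i) := by rw [hM, ← Real.rpow_add ht0, ← Real.rpow_sub ht0, two_mul]
      _ ≤ _ := Real.rpow_le_rpow_of_exponent_le ht (hερ i)
  refine ⟨x, y, ?_, fun j => ?_, fun i => ?_⟩
  · intro h
    -- The zero vector would give |η_{i₀}| ≤ t^(−bρ_{i₀}), which fails for large t. This is where η
    -- ≠ 0 is needed.
    rw [Prod.mk_eq_zero] at h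
    have h3 := herr i₀
    rw [h.1, h.2] at h3
    simp only [Pi.zero_apply, Int.cast_zero, sub_zero, zero_sub, Matrix.mulVec, dotProduct,
      mul_zero, Finset.sum_const_zero, abs_neg] at h3
    rw [neg_mul, Real.rpow_neg ht0.le] at h3
    have h4 := inv_lt_of_inv_lt₀ hη0 ht5
    linarith
  · have h3 : ((|x j| : ℤ) : ℝ) ≤ ((k * X j : ℕ) : ℤ) := by exact_mod_cast hx j
    push_cast at h3
    refine h3.trans ?_
    have h4 : (X j : ℝ) ≤ 2 * (M * t ^ (γ * σ j)) := by
      have h5 : (X j : ℝ) < M * t ^ (γ * σ j) + 1 :=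
        Nat.ceil_lt_add_one (mul_pos hM0 (htγ j)).le
      have h6 : 1 ≤ t ^ (γ * σ j) := Real.one_le_rpow ht (mul_pos hγ (hσ.pos j)).le
      have h7 : 1 ≤ M * t ^ (γ * σ j) := one_le_mul_of_one_le_of_one_le hM1 h6
      linarith
    calc (k : ℝ) * X j ≤ k * (2 * (M * t ^ (γ * σ j))) := mul_le_mul_of_nonneg_left h4 hk0.le
      _ = (2 * k) * (M * t ^ (γ * σ j)) := by ring
      _ ≤ M * (M * t ^ (γ * σ j)) :=
        mul_le_mul_of_nonneg_right ht1 (mul_pos hM0 (htγ j)).le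
      _ = t ^ (γ * σ j + 2 * ε) := by
        rw [hM, ← Real.rpow_add ht0, ← Real.rpow_add ht0]; congr 1; ring
      _ ≤ t ^ (a * σ j) := Real.rpow_le_rpow_of_exponent_le ht (hεσ j)
      _ = _ := Real.rpow_mul ht0.le _ _
  · refine (herr i).trans (le_of_eq ?_)
    beta_reduce
    rw [← Real.rpow_mul ht0.le]
    congr 1
    rw [← hag]
    ring

/-- Upper bounds for the exponent of the transposed matrix bound the uniform inhomogeneous
exponent from below. -/
theorem inv_le_inhomUniformExponent {m n : ℕ} {σ : Fin m → ℝ} {ρ : Fin n → ℝ}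
    (hσ : IsWeight σ) (hρ : IsWeight ρ) (Θ : Matrix (Fin n) (Fin m) ℝ) (η : Fin n → ℝ) {B : ℝ}
    (h : weightedExponent ρ σ Θ.transpose ≤ B) :
    ((B⁻¹ : ℝ) : EReal) ≤ inhomUniformExponent σ ρ Θ η := by
  have hB : 1 ≤ B := by exact_mod_cast (one_le_weightedExponent hρ hσ Θ.transpose).trans h
  have hB0 : 0 < B := by linarith
  -- For η = 0 Kronecker's theorem could return the zero vector; there 1/B ≤ 1 and Dirichlet's bound
  -- suffices.
  rcases eq_or_ne η 0 with rfl | hη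
  · refine le_trans ?_ (one_le_weightedUniformExponent hσ hρ Θ)
    exact_mod_cast inv_le_one_of_one_le₀ hB
  refine coe_le_of_forall_Ioo_lt (inv_pos.2 hB0) fun g hg hgB => ?_
  obtain ⟨γ, hBγ, hγg⟩ := exists_between ((lt_inv_comm₀ hg hB0).1 hgB)
  have hγ : 0 < γ := hB0.trans hBγ
  obtain ⟨a, ha, hev⟩ := exists_solution_of_not_transpose hσ hρ Θ hη hγ hg
    (by
      have := mul_lt_mul_of_pos_left hγg hg
      rwa [mul_inv_cancel₀ hg.ne'] at this)
  have hno : ∀ᶠ t : ℝ in Filter.atTop, ¬ HasNonzeroSolution ρ σ Θ.transpose 0 γ t := by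
    by_contra hcon
    rw [Filter.not_eventually] at hcon
    have : (γ : EReal) ≤ weightedExponent ρ σ Θ.transpose := by
      refine le_inhomExponent fun T => ?_
      obtain ⟨t, ht, hs⟩ := Filter.frequently_atTop.1 hcon T
      exact ⟨t, ht, not_not.1 hs⟩
    have h2 : γ ≤ B := by exact_mod_cast this.trans h
    linarith
  have hall := hev.and hno
  have htend := tendsto_rpow_atTop (inv_pos.2 ha)
  have h3 : ∀ᶠ s : ℝ in Filter.atTop, HasNonzeroSolution σ ρ Θ η g s := by
    filter_upwards [htend.eventually hall, Filter.eventually_ge_atTop 0] with s hs hs0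
    have := hs.1 hs.2
    rwa [← Real.rpow_mul hs0, inv_mul_cancel₀ ha.ne', Real.rpow_one] at this
  exact le_inhomUniformExponent (Filter.eventually_atTop.1 h3)

/-- Upper bounds for the uniform exponent of the transposed matrix bound the inhomogeneous
exponent from below. -/
theorem inv_le_inhomExponent {m n : ℕ} {σ : Fin m → ℝ} {ρ : Fin n → ℝ}
    (hσ : IsWeight σ) (hρ : IsWeight ρ) (Θ : Matrix (Fin n) (Fin m) ℝ) (η : Fin n → ℝ) {B : ℝ}
    (h : weightedUniformExponent ρ σ Θ.transpose ≤ B) :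
    ((B⁻¹ : ℝ) : EReal) ≤ inhomExponent σ ρ Θ η := by
  have hB : 1 ≤ B := by exact_mod_cast (one_le_weightedUniformExponent hρ hσ Θ.transpose).trans h
  have hB0 : 0 < B := by linarith
  rcases eq_or_ne η 0 with rfl | hη
  · refine le_trans ?_ (one_le_weightedExponent hσ hρ Θ)
    exact_mod_cast inv_le_one_of_one_le₀ hB
  refine coe_le_of_forall_Ioo_lt (inv_pos.2 hB0) fun g hg hgB => ?_
  obtain ⟨γ, hBγ, hγg⟩ := exists_between ((lt_inv_comm₀ hg hB0).1 hgB)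
  have hγ : 0 < γ := hB0.trans hBγ
  obtain ⟨a, ha, hev⟩ := exists_solution_of_not_transpose hσ hρ Θ hη hγ hg
    (by
      have := mul_lt_mul_of_pos_left hγg hg
      rwa [mul_inv_cancel₀ hg.ne'] at this)
  have hno : ∃ᶠ t : ℝ in Filter.atTop, ¬ HasNonzeroSolution ρ σ Θ.transpose 0 γ t := by
    intro hcon
    simp only [not_not] at hcon
    have : (γ : EReal) ≤ weightedUniformExponent ρ σ Θ.transpose :=
      le_inhomUniformExponent (Filter.eventually_atTop.1 hcon)
    have h2 : γ ≤ B := by exact_mod_cast this.trans h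
    linarith
  refine le_inhomExponent fun T => ?_
  obtain ⟨t, hs, h1, h2⟩ := (hno.and_eventually
    (hev.and (eventually_le_rpow ha T))).exists
  exact ⟨t ^ a, h2, h1 hs⟩

/-! ### Transference for the ordinary exponents. -/

/-- Constant factors do not matter for the exponents. -/
theorem BoxSolution.hasNonzeroSolution {m n : ℕ} {σ : Fin m → ℝ} {ρ : Fin n → ℝ}
    (hσ : ∀ j, 0 < σ j) (hρ : ∀ i, 0 < ρ i) (Θ : Matrix (Fin n) (Fin m) ℝ) (C : ℝ) {β γ : ℝ}
    (h : γ < β) :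
    ∃ K : ℝ, 1 ≤ K ∧ ∀ᶠ T : ℝ in Filter.atTop,
      BoxSolution Θ 0 (fun j => C * T ^ σ j) (fun i => C * T ^ (-β * ρ i)) →
        HasNonzeroSolution σ ρ Θ 0 γ (K * T) := by
  obtain ⟨ε, hε, hεσ⟩ := exists_pos_le_of_forall_pos hσ
  -- Rescaling T by K absorbs C in the bounds on x; in the error bounds C is absorbed by the loss
  -- from β to γ.
  set K : ℝ := max C 1 ^ (ε⁻¹) with hK
  have hC1 : 1 ≤ max C 1 := le_max_right _ _
  have hK1 : 1 ≤ K := Real.one_le_rpow hC1 (by positivity)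
  have hK0 : 0 < K := by linarith
  have hKε : ∀ j, C ≤ K ^ σ j := by
    intro j
    calc C ≤ max C 1 := le_max_left _ _
      _ = K ^ ε := by rw [hK, Real.rpow_inv_rpow (by linarith) hε.ne']
      _ ≤ _ := Real.rpow_le_rpow_of_exponent_le hK1 (hεσ j)
  refine ⟨K, hK1, ?_⟩
  have hev : ∀ᶠ T : ℝ in Filter.atTop, ∀ i, C * K ^ (γ * ρ i) ≤ T ^ ((β - γ) * ρ i) :=
    Filter.eventually_all.2 fun i => eventually_le_rpow (mul_pos (sub_pos.2 h) (hρ i)) _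
  filter_upwards [hev, Filter.eventually_gt_atTop 0] with T hT hT0 hbox
  rw [hasNonzeroSolution_iff hσ hρ (mul_pos hK0 hT0)]
  refine hbox.mono (fun j => ?_) fun i => ?_
  · rw [Real.mul_rpow hK0.le hT0.le]
    exact mul_le_mul_of_nonneg_right (hKε j) (Real.rpow_nonneg hT0.le _)
  · have h1 := mul_le_mul_of_nonneg_right (hT i)
      (mul_pos (Real.rpow_pos_of_pos hK0 (-γ * ρ i)) (Real.rpow_pos_of_pos hT0 (-β * ρ i))).le
    have e1 : C * K ^ (γ * ρ i) * (K ^ (-γ * ρ i) * T ^ (-β * ρ i))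
        = C * T ^ (-β * ρ i) := by
      have : K ^ (γ * ρ i) * K ^ (-γ * ρ i) = 1 := by
        rw [← Real.rpow_add hK0, neg_mul, add_neg_cancel, Real.rpow_zero]
      calc _ = C * T ^ (-β * ρ i) * (K ^ (γ * ρ i) * K ^ (-γ * ρ i)) := by ring
        _ = _ := by rw [this, mul_one]
    have e2 : T ^ ((β - γ) * ρ i) * (K ^ (-γ * ρ i) * T ^ (-β * ρ i))
        = (K * T) ^ (-γ * ρ i) := by
      rw [Real.mul_rpow hK0.le hT0.le, mul_left_comm, ← Real.rpow_add hT0]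
      congr 2
      ring
    rwa [e1, e2] at h1

theorem le_weightedExponent_of_boxSolution {m n : ℕ} {σ : Fin m → ℝ} {ρ : Fin n → ℝ}
    (hσ : ∀ j, 0 < σ j) (hρ : ∀ i, 0 < ρ i) {Θ : Matrix (Fin n) (Fin m) ℝ} {C β : ℝ}
    (h : ∃ᶠ T : ℝ in Filter.atTop,
      BoxSolution Θ 0 (fun j => C * T ^ σ j) (fun i => C * T ^ (-β * ρ i))) :
    (β : EReal) ≤ weightedExponent σ ρ Θ := by
  refine coe_le_of_forall_lt fun γ hγ => le_inhomExponent fun T₀ => ?_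
  obtain ⟨K, hK, hev⟩ := BoxSolution.hasNonzeroSolution hσ hρ Θ C hγ
  obtain ⟨T, hT, h1, h2⟩ :=
    (h.and_eventually (hev.and (Filter.eventually_ge_atTop (max T₀ 0)))).exists
  refine ⟨K * T, ?_, h1 hT⟩
  have h3 : 0 ≤ T := (le_max_right _ _).trans h2
  have h4 : T₀ ≤ T := (le_max_left _ _).trans h2
  nlinarith

theorem le_weightedUniformExponent_of_boxSolution {m n : ℕ} {σ : Fin m → ℝ} {ρ : Fin n → ℝ}
    (hσ : ∀ j, 0 < σ j) (hρ : ∀ i, 0 < ρ i) {Θ : Matrix (Fin n) (Fin m) ℝ} {C β : ℝ}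
    (h : ∀ᶠ T : ℝ in Filter.atTop,
      BoxSolution Θ 0 (fun j => C * T ^ σ j) (fun i => C * T ^ (-β * ρ i))) :
    (β : EReal) ≤ weightedUniformExponent σ ρ Θ := by
  refine coe_le_of_forall_lt fun γ hγ => le_inhomUniformExponent ?_
  obtain ⟨K, hK, hev⟩ := BoxSolution.hasNonzeroSolution hσ hρ Θ C hγ
  obtain ⟨T₀, hT₀⟩ := Filter.eventually_atTop.1 (h.and hev)
  have hK0 : 0 < K := by linarith
  refine ⟨K * T₀, fun t ht => ?_⟩
  have h1 := hT₀ (t / K) (by rw [le_div_iff₀ hK0]; linarith)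
  have h2 := h1.2 h1.1
  rwa [mul_div_cancel₀ t hK0.ne'] at h2

theorem IsWeight.apply_eq_one {ρ : Fin 1 → ℝ} (hρ : IsWeight ρ) (i : Fin 1) : ρ i = 1 := by
  have := hρ.sum_eq_one
  rw [Fin.sum_univ_one] at this
  rwa [Subsingleton.elim i 0]

/-- Transference from simultaneous approximation to a linear form. -/
theorem le_weightedExponent_row {m : ℕ} (hm : 0 < m) {σ : Fin m → ℝ} {ρ : Fin 1 → ℝ}
    (hσ : IsWeight σ) (hρ : IsWeight ρ) {s : ℝ} (hs : ∀ j, s ≤ σ j)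
    (Θ : Matrix (Fin 1) (Fin m) ℝ) {γ : ℝ} (hγ : 1 ≤ γ)
    (h : ∃ᶠ t : ℝ in Filter.atTop, HasNonzeroSolution ρ σ Θ.transpose 0 γ t) :
    (((1 - s) + s * γ : ℝ) : EReal) ≤ weightedExponent σ ρ Θ := by
  refine le_weightedExponent_of_boxSolution (C := transferConst m 1) hσ.pos hρ.pos ?_
  refine (h.and_eventually (Filter.eventually_ge_atTop 1)).mono fun t => ?_
  rintro ⟨hsol, ht⟩
  have ht0 : 0 < t := by linarith
  rw [hasNonzeroSolution_iff hρ.pos hσ.pos ht0] at hsol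
  obtain ⟨q, p, h0, hq, hp⟩ := hsol
  -- Chosen so that 1 − β = s(1 − γ), which bounds every σ_j(1 − γ) because γ ≥ 1.
  set β := (1 - s) + s * γ with hβ
  have hρ1 := hρ.apply_eq_one
  have hP : (∏ j, t ^ σ j) * ∏ i, t ^ (-β * ρ i) = t ^ (1 - β) := by
    have h1 : ∏ j, t ^ σ j = t ^ (1 : ℝ) := by
      simpa using prod_rpow_weight hσ.sum_eq_one ht0 1
    rw [h1, prod_rpow_weight hρ.sum_eq_one ht0, ← Real.rpow_add ht0, sub_eq_add_neg]
  refine boxSolution_of_transpose hm one_pos Θ (fun j => Real.rpow_pos_of_pos ht0 _)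
    (fun i => Real.rpow_pos_of_pos ht0 _) h0 (fun i => ?_) fun j => ?_
  · rw [hP]
    refine (mul_le_mul_of_nonneg_right (hq i) (Real.rpow_nonneg ht0.le _)).trans (le_of_eq ?_)
    beta_reduce
    rw [hρ1, ← Real.rpow_add ht0]
    congr 1
    ring
  · rw [hP]
    have := hp j
    rw [Pi.zero_apply, sub_zero] at this
    refine (mul_le_mul_of_nonneg_right this (Real.rpow_nonneg ht0.le _)).trans ?_
    rw [← Real.rpow_add ht0]
    apply Real.rpow_le_rpow_of_exponent_le ht
    nlinarith [hs j]

/-- Transference from a linear form to simultaneous approximation. -/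
theorem le_weightedExponent_col {m : ℕ} (hm : 0 < m) {σ : Fin m → ℝ} {ρ : Fin 1 → ℝ}
    (hσ : IsWeight σ) (hρ : IsWeight ρ) {s : ℝ} (hs : ∀ j, s ≤ σ j) (hs0 : 0 < s) (hs1 : s < 1)
    (Θ : Matrix (Fin 1) (Fin m) ℝ) {γ : ℝ} (hγ : 1 ≤ γ)
    (h : ∃ᶠ t : ℝ in Filter.atTop, HasNonzeroSolution σ ρ Θ 0 γ t) :
    ((γ / (γ * (1 - s) + s) : ℝ) : EReal) ≤ weightedExponent ρ σ Θ.transpose := by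
  refine le_weightedExponent_of_boxSolution (C := transferConst 1 m) hρ.pos hσ.pos ?_
  -- The new height is t^c, and c is fixed by c − γ = s(1 − γ); its error bounds are again
  -- t^(−γσ_j).
  set c := γ * (1 - s) + s with hc
  have hc0 : 0 < c := by
    have : 0 < γ * (1 - s) := mul_pos (by linarith) (by linarith)
    linarith
  have htend : Filter.Tendsto (fun t : ℝ => t ^ c) Filter.atTop Filter.atTop :=
    tendsto_rpow_atTop hc0
  refine htend.frequently ((h.and_eventually (Filter.eventually_ge_atTop 1)).mono fun t => ?_)
  rintro ⟨hsol, ht⟩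
  have ht0 : 0 < t := by linarith
  rw [hasNonzeroSolution_iff hσ.pos hρ.pos ht0] at hsol
  obtain ⟨x, y, h0, hx, hy⟩ := hsol
  have hρ1 := hρ.apply_eq_one
  have hQ0 : 0 < t ^ c := Real.rpow_pos_of_pos ht0 _
  have e1 : ∀ j, (t ^ c) ^ (-(γ / c) * σ j) = t ^ (-γ * σ j) := by
    intro j
    rw [← Real.rpow_mul ht0.le]
    congr 1
    field_simp
  have e2 : ∀ i, (t ^ c) ^ ρ i = t ^ c := by
    intro i
    rw [hρ1, Real.rpow_one]
  have hP : (∏ i, (t ^ c) ^ ρ i) * ∏ j, (t ^ c) ^ (-(γ / c) * σ j) = t ^ (c - γ) := by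
    rw [Finset.prod_congr rfl fun j _ => e1 j, prod_rpow_weight hσ.sum_eq_one ht0,
      Fin.prod_univ_one, e2, ← Real.rpow_add ht0, sub_eq_add_neg]
  refine boxSolution_of_transpose one_pos hm Θ.transpose (fun j => Real.rpow_pos_of_pos hQ0 _)
    (fun i => Real.rpow_pos_of_pos hQ0 _) h0 (fun j => ?_) fun i => ?_
  · rw [hP, e1]
    refine (mul_le_mul_of_nonneg_right (hx j) (Real.rpow_nonneg ht0.le _)).trans ?_
    rw [← Real.rpow_add ht0]
    apply Real.rpow_le_rpow_of_exponent_le ht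
    nlinarith [hs j]
  · rw [hP, e2, Matrix.transpose_transpose]
    have := hy i
    rw [Pi.zero_apply, sub_zero] at this
    refine (mul_le_mul_of_nonneg_right this hQ0.le).trans (le_of_eq ?_)
    beta_reduce
    rw [hρ1, ← Real.rpow_add ht0]
    congr 1
    ring

/-! ### Uniform transference from simultaneous approximation to a linear form. -/

theorem transpose_mulVec_fin_one {m : ℕ} (Θ : Matrix (Fin 1) (Fin m) ℝ) (q : Fin 1 → ℤ)
    (j : Fin m) : Θ.transpose.mulVec (fun i => (q i : ℝ)) j = Θ 0 j * q 0 := by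
  simp [Matrix.mulVec, dotProduct]

/-- Each of the finitely many nonzero q with |q| ≤ B keeps αq at a positive distance from the
integers. -/
theorem eventually_large_denominator {α c : ℝ} (hα : Irrational α) (hc : 0 < c) (B : ℕ) :
    ∀ᶠ U : ℝ in Filter.atTop, ∀ q p : ℤ, q ≠ 0 → |α * q - p| ≤ U ^ (-c) → B < q.natAbs := by
  have h : ∀ q ∈ Finset.Icc (-(B : ℤ)) B, ∀ᶠ U : ℝ in Filter.atTop,
      q ≠ 0 → ∀ p : ℤ, U ^ (-c) < |α * q - p| := by
    intro q _
    by_cases hq : q = 0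
    · simp [hq]
    · have hirr : Irrational (α * q) := hα.mul_intCast hq
      have hpos : 0 < |α * q - round (α * q)| := by
        rw [abs_pos, sub_ne_zero]
        exact hirr.ne_int _
      filter_upwards [(tendsto_rpow_neg_atTop hc).eventually_lt_const hpos] with U hU _ p
      exact hU.trans_le (round_le _ _)
  filter_upwards [(Filter.eventually_all_finset _).2 h] with U hU q p hq hle
  by_contra hB
  refine absurd hle (not_le.2 (hU q ?_ hq p))
  rw [Finset.mem_Icc]
  omega

/-- Two independent good simultaneous approximations with denominators of controlled size. -/
theorem exists_independent_approximations {m : ℕ} {σ : Fin m → ℝ} {ρ : Fin 1 → ℝ}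
    (hσ : IsWeight σ) (hρ : IsWeight ρ) (Θ : Matrix (Fin 1) (Fin m) ℝ)
    (hΘ : ∃ j, Irrational (Θ 0 j)) {γ : ℝ} (hγ : 0 < γ)
    (h : ∀ᶠ t : ℝ in Filter.atTop, HasNonzeroSolution ρ σ Θ.transpose 0 γ t) (B : ℝ) :
    ∀ᶠ U : ℝ in Filter.atTop, ∃ (q q' : ℤ) (p p' : Fin m → ℤ), B ≤ |(q : ℝ)| / 2 ∧
      |(q : ℝ)| ≤ U ∧ |(q' : ℝ)| ≤ |(q : ℝ)| / 2 ∧ (q, p) ≠ 0 ∧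
      (∀ j, |Θ 0 j * q - p j| ≤ U ^ (-γ * σ j)) ∧
      (∀ j, |Θ 0 j * q' - p' j| ≤ (|(q : ℝ)| / 2) ^ (-γ * σ j)) ∧
      ∃ j, (q : ℝ) * (Θ 0 j * q' - p' j) - q' * (Θ 0 j * q - p j) ≠ 0 := by
  have hρ1 := hρ.apply_eq_one
  have hsol : ∀ t : ℝ, 0 < t → HasNonzeroSolution ρ σ Θ.transpose 0 γ t →
      ∃ (q : ℤ) (p : Fin m → ℤ), (q, p) ≠ 0 ∧ |(q : ℝ)| ≤ t ∧
        ∀ j, |Θ 0 j * q - p j| ≤ t ^ (-γ * σ j) := by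
    intro t ht hs
    rw [hasNonzeroSolution_iff hρ.pos hσ.pos ht] at hs
    obtain ⟨q, p, h0, hq, hp⟩ := hs
    refine ⟨q 0, p, ?_, ?_, fun j => ?_⟩
    · intro h1
      apply h0
      rw [Prod.mk_eq_zero] at h1 ⊢
      refine ⟨funext fun i => ?_, h1.2⟩
      rw [Subsingleton.elim i 0]
      exact h1.1
    · have := hq 0
      beta_reduce at this
      rwa [hρ1, Real.rpow_one] at this
    · have := hp j
      rwa [Pi.zero_apply, sub_zero, transpose_mulVec_fin_one] at this
  obtain ⟨j₀, hj₀⟩ := hΘ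
  obtain ⟨T₀, hT₀⟩ := Filter.eventually_atTop.1 h
  obtain ⟨b, hb⟩ := exists_nat_gt (2 * max (max B T₀) 1)
  filter_upwards [h, Filter.eventually_gt_atTop 1,
    eventually_large_denominator hj₀ (mul_pos hγ (hσ.pos j₀)) b] with U hU hU1 hlarge
  have hU0 : 0 < U := by linarith
  classical
  -- The denominator q is taken minimal for the error level U^(−γσ_j), and the second solution comes
  -- from height |q|/2.
  let S : Set ℕ := {k | ∃ (q : ℤ) (p : Fin m → ℤ), q.natAbs = k ∧ (q, p) ≠ 0 ∧
    ∀ j, |Θ 0 j * q - p j| ≤ U ^ (-γ * σ j)}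
  obtain ⟨q₁, p₁, h01, hq₁, hp₁⟩ := hsol U hU0 hU
  have hS : S.Nonempty := ⟨_, q₁, p₁, rfl, h01, hp₁⟩
  obtain ⟨q, p, hk, h0, hp⟩ := Nat.sInf_mem hS
  have hmin : ∀ (q' : ℤ) (p' : Fin m → ℤ), (q', p') ≠ 0 →
      (∀ j, |Θ 0 j * q' - p' j| ≤ U ^ (-γ * σ j)) → q.natAbs ≤ q'.natAbs := by
    intro q' p' h0' hp'
    rw [hk]
    exact Nat.sInf_le ⟨q', p', rfl, h0', hp'⟩
  have hnat : ∀ q : ℤ, |(q : ℝ)| = (q.natAbs : ℝ) := fun q => by simp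
  have hq0 : q ≠ 0 := by
    rintro rfl
    apply h0
    rw [Prod.mk_eq_zero]
    refine ⟨rfl, funext fun j => ?_⟩
    have h1 := hp j
    rw [Int.cast_zero, mul_zero, zero_sub, abs_neg] at h1
    have h2 : U ^ (-γ * σ j) < 1 :=
      Real.rpow_lt_one_of_one_lt_of_neg hU1 (by nlinarith [hσ.pos j])
    have h3 : |(p j : ℝ)| < 1 := h1.trans_lt h2
    have h4 : |p j| < 1 := by exact_mod_cast h3
    exact Int.abs_lt_one_iff.1 h4
  have hqb : (b : ℝ) < |(q : ℝ)| := by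
    have := hlarge q (p j₀) hq0 (by rw [← neg_mul]; exact hp j₀)
    rw [hnat]
    exact_mod_cast this
  have hq2 : max (max B T₀) 1 ≤ |(q : ℝ)| / 2 := by linarith
  have hqT : T₀ ≤ |(q : ℝ)| / 2 := ((le_max_right _ _).trans (le_max_left _ _)).trans hq2
  have hqB : B ≤ |(q : ℝ)| / 2 := ((le_max_left _ _).trans (le_max_left _ _)).trans hq2
  have hq1 : 1 ≤ |(q : ℝ)| / 2 := (le_max_right _ _).trans hq2
  obtain ⟨q', p', h0', hq', hp'⟩ := hsol (|(q : ℝ)| / 2) (by linarith) (hT₀ _ hqT)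
  refine ⟨q, q', p, p', hqB, ?_, hq', h0, hp, hp', ?_⟩
  · refine le_trans ?_ hq₁
    rw [hnat, hnat]
    exact_mod_cast hmin q₁ p₁ h01 hp₁
  -- If the two were proportional, the errors of q' would be no larger than those of q, so
  -- minimality would give |q| ≤ |q'| ≤ |q|/2.
  · by_contra hcon
    push Not at hcon
    have hqpos : 0 < |(q : ℝ)| := by linarith
    have hle : q.natAbs ≤ q'.natAbs := by
      refine hmin q' p' h0' fun j => le_trans ?_ (hp j)
      have h1 : |(q : ℝ)| * |Θ 0 j * q' - p' j| = |(q' : ℝ)| * |Θ 0 j * q - p j| := by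
        rw [← abs_mul, ← abs_mul, sub_eq_zero.1 (hcon j)]
      refine le_of_mul_le_mul_left ?_ hqpos
      rw [h1]
      exact mul_le_mul_of_nonneg_right (by linarith) (abs_nonneg _)
    have hle' : |(q : ℝ)| ≤ |(q' : ℝ)| := by
      rw [hnat, hnat]; exact_mod_cast hle
    linarith

/-- The determinants of the two approximations. -/
theorem abs_wedge_le {a q q' e e' U γ σ : ℝ} (ha : a = |q| / 2) (ha1 : 0 < a) (hU : |q| ≤ U)
    (hγσ : 0 ≤ γ * σ) (hq' : |q'| ≤ |q| / 2) (he : |e| ≤ U ^ (-γ * σ))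
    (he' : |e'| ≤ a ^ (-γ * σ)) : |q * e' - q' * e| ≤ 4 * a ^ (1 - γ * σ) := by
  have hq : |q| = 2 * a := by rw [ha]; ring
  have h1 : U ^ (-γ * σ) ≤ a ^ (-γ * σ) := by
    rw [neg_mul]
    exact Real.rpow_le_rpow_of_nonpos ha1 (by linarith) (by linarith)
  have h2 : a ^ (1 - γ * σ) = a * a ^ (-γ * σ) := by
    rw [sub_eq_add_neg, Real.rpow_add ha1, Real.rpow_one, neg_mul]
  have h3 : 0 ≤ a ^ (-γ * σ) := Real.rpow_nonneg ha1.le _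
  calc |q * e' - q' * e| ≤ |q| * |e'| + |q'| * |e| := by
        rw [← abs_mul, ← abs_mul]; exact abs_sub _ _
    _ ≤ (2 * a) * a ^ (-γ * σ) + a * a ^ (-γ * σ) := by
        rw [hq] at hq' ⊢
        have := he.trans h1
        have h5 : |q'| ≤ a := by linarith
        gcongr
    _ ≤ _ := by
        rw [h2]
        nlinarith [mul_nonneg ha1.le h3]

/-- The minors q'p_j − qp'_j are integers of size at most 4a^(1 − γσ_j). If sγ > 1 they would all
vanish for large a, against independence. -/
theorem mul_le_one_of_eventually {m : ℕ} {σ : Fin m → ℝ} {ρ : Fin 1 → ℝ}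
    (hσ : IsWeight σ) (hρ : IsWeight ρ) {s : ℝ} (hs : ∀ j, s ≤ σ j)
    (Θ : Matrix (Fin 1) (Fin m) ℝ) (hΘ : ∃ j, Irrational (Θ 0 j)) {γ : ℝ} (hγ : 0 < γ)
    (h : ∀ᶠ t : ℝ in Filter.atTop, HasNonzeroSolution ρ σ Θ.transpose 0 γ t) : s * γ ≤ 1 := by
  by_contra hcon
  push Not at hcon
  have h1 : 0 < s * γ - 1 := by linarith
  obtain ⟨B, hB⟩ := Filter.eventually_atTop.1 (eventually_le_rpow h1 5)
  obtain ⟨U, q, q', p, p', hqB, hqU, hq', -, hp, hp', j, hj⟩ :=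
    (exists_independent_approximations hσ hρ Θ hΘ hγ h (max B 1)).exists
  set a := |(q : ℝ)| / 2 with ha
  have ha1 : 1 ≤ a := (le_max_right _ _).trans hqB
  have ha0 : 0 < a := by linarith
  have h2 := abs_wedge_le ha ha0 hqU (mul_pos hγ (hσ.pos j)).le hq' (hp j) (hp' j)
  have h3 : a ^ (1 - γ * σ j) ≤ a ^ (-(s * γ - 1)) :=
    Real.rpow_le_rpow_of_exponent_le ha1 (by nlinarith [hs j])
  have h4 := hB a ((le_max_left _ _).trans hqB)
  have h5 : a ^ (-(s * γ - 1)) ≤ 1 / 5 := by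
    rw [Real.rpow_neg ha0.le, ← one_div]
    exact one_div_le_one_div_of_le (by norm_num) h4
  have e : (q : ℝ) * (Θ 0 j * q' - p' j) - q' * (Θ 0 j * q - p j)
      = ((q' * p j - q * p' j : ℤ) : ℝ) := by push_cast; ring
  rw [e] at hj h2
  have h6 : |((q' * p j - q * p' j : ℤ) : ℝ)| < 1 := by linarith
  have h7 : |q' * p j - q * p' j| < 1 := by exact_mod_cast h6
  exact hj (by rw [Int.abs_lt_one_iff.1 h7]; simp)

/-- Uniform transference from simultaneous approximation to a linear form. -/
theorem le_weightedUniformExponent_row {m : ℕ} (hm : 2 ≤ m) {σ : Fin m → ℝ} {ρ : Fin 1 → ℝ}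
    (hσ : IsWeight σ) (hρ : IsWeight ρ) {s : ℝ} (hs : ∀ j, s ≤ σ j) (hs0 : 0 < s) (hs1 : s < 1)
    (Θ : Matrix (Fin 1) (Fin m) ℝ) (hΘ : ∃ j, Irrational (Θ 0 j)) {γ : ℝ} (hγ : 1 ≤ γ)
    (hsγ : s * γ < 1)
    (h : ∀ᶠ t : ℝ in Filter.atTop, HasNonzeroSolution ρ σ Θ.transpose 0 γ t) :
    (((1 - s) / (1 - s * γ) : ℝ) : EReal) ≤ weightedUniformExponent σ ρ Θ := by
  set β := (1 - s) / (1 - s * γ) with hβ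
  -- The defining relation of β: with U = T^β it makes both T^σ_j U^(−γσ_j) ≤ T^(1 − β) and T^σ_j
  -- U^(1 − γσ_j) ≤ T.
  have hβeq : s * (1 - β * γ) = 1 - β := by
    have : β * (1 - s * γ) = 1 - s := div_mul_cancel₀ _ (by linarith)
    linarith
  have hβ1 : 1 ≤ β := by
    rw [hβ, le_div_iff₀ (by linarith)]
    nlinarith
  have hβγ : 1 ≤ β * γ := one_le_mul_of_one_le_of_one_le hβ1 hγ
  have hγ0 : 0 < γ := by linarith
  have hρ1 := hρ.apply_eq_one
  have hσ1 : ∀ j, σ j ≤ 1 := fun j => by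
    rw [← hσ.sum_eq_one]
    exact Finset.single_le_sum (fun i _ => (hσ.pos i).le) (Finset.mem_univ j)
  refine le_weightedUniformExponent_of_boxSolution (C := transferConst m 1 * 4)
    hσ.pos hρ.pos ?_
  have hev := (tendsto_rpow_atTop (show 0 < β by linarith)).eventually
    (exists_independent_approximations hσ hρ Θ hΘ hγ0 h 1)
  filter_upwards [hev, Filter.eventually_ge_atTop 1] with T hT hT1
  obtain ⟨q, q', p, p', hqB, hqU, hq', h0, hp, hp', hne⟩ := hT
  have hT0 : 0 < T := by linarith
  set a := |(q : ℝ)| / 2 with ha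
  have ha0 : 0 < a := by linarith
  have hUσ : ∀ j, (T ^ β) ^ (-γ * σ j) = T ^ (-(β * γ) * σ j) := by
    intro j
    rw [← Real.rpow_mul hT0.le]
    congr 1
    ring
  have hprodσ : ∏ j, T ^ σ j = T := by
    simpa using prod_rpow_weight hσ.sum_eq_one hT0 1
  have hεA : ∀ j, |Θ 0 j * q - p j| * T ^ σ j ≤ T ^ (1 - β) := by
    intro j
    have h1 := hp j
    rw [hUσ] at h1
    refine (mul_le_mul_of_nonneg_right h1 (Real.rpow_nonneg hT0.le _)).trans ?_
    rw [← Real.rpow_add hT0]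
    apply Real.rpow_le_rpow_of_exponent_le hT1
    nlinarith [hs j]
  have hA0 : ∀ j, 0 < T ^ σ j := fun j => Real.rpow_pos_of_pos hT0 _
  have hδ0 : 0 < T ^ (-β) := Real.rpow_pos_of_pos hT0 _
  have hC0 : 0 ≤ transferConst m 1 := by rw [transferConst]; positivity
  -- If the coordinate q does not dominate, |q|T^(−β) is below T^(1 − β) and one dual vector
  -- suffices; if it dominates, it serves as pivot for the pair.
  by_cases hcase : ∃ j, |(q : ℝ)| * T ^ (-β) < |Θ 0 j * q - p j| * T ^ σ j
  · obtain ⟨j₁, hj₁⟩ := hcase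
    have hP : (∏ j, T ^ σ j) * ∏ i, T ^ (-β * ρ i) = T ^ (1 - β) := by
      rw [hprodσ, prod_rpow_weight hρ.sum_eq_one hT0, sub_eq_add_neg, Real.rpow_add hT0,
        Real.rpow_one]
    have hbox := boxSolution_of_transpose (by omega) one_pos Θ hA0
      (B := fun i => T ^ (-β * ρ i)) (fun i => Real.rpow_pos_of_pos hT0 _)
      (q := fun _ => q) (p := p)
      (by
        intro h1
        apply h0
        rw [Prod.mk_eq_zero] at h1 ⊢
        exact ⟨congrFun h1.1 0, h1.2⟩)
      (by
        intro i
        rw [hP, hρ1, mul_one]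
        exact hj₁.le.trans (hεA j₁))
      (by
        intro j
        rw [hP, transpose_mulVec_fin_one Θ (fun _ => q)]
        exact hεA j)
    refine hbox.mono (fun j => ?_) fun i => ?_
    · rw [mul_assoc]
      exact mul_le_mul_of_nonneg_left (by linarith [hA0 j]) hC0
    · rw [mul_assoc]
      refine mul_le_mul_of_nonneg_left ?_ hC0
      have := Real.rpow_nonneg hT0.le (-β * ρ i)
      linarith
  · push Not at hcase
    have hbox := boxSolution_row_of_pair hm Θ (A := fun j => 4 * T ^ σ j) (δ := 4 * T ^ (-β))
      (fun j => by linarith [hA0 j]) (by linarith) (q := q) (q' := q') (p := p) (p' := p')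
      (fun j => by linarith [hcase j])
      (by
        intro j
        rw [Finset.prod_mul_distrib, hprodσ, Finset.prod_const, Finset.card_univ,
          Fintype.card_fin]
        have h1 := abs_wedge_le ha ha0 hqU (mul_pos hγ0 (hσ.pos j)).le hq' (hp j) (hp' j)
        have h2 : a ^ (1 - γ * σ j) * T ^ σ j ≤ T := by
          rcases le_total (γ * σ j) 1 with h3 | h3
          · have h4 : a ^ (1 - γ * σ j) ≤ (T ^ β) ^ (1 - γ * σ j) :=
              Real.rpow_le_rpow ha0.le (by linarith) (by linarith)
            refine (mul_le_mul_of_nonneg_right h4 (hA0 j).le).trans ?_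
            rw [← Real.rpow_mul hT0.le, ← Real.rpow_add hT0]
            conv_rhs => rw [← Real.rpow_one T]
            apply Real.rpow_le_rpow_of_exponent_le hT1
            nlinarith [hs j]
          · have h4 : a ^ (1 - γ * σ j) ≤ 1 :=
              Real.rpow_le_one_of_one_le_of_nonpos hqB (by linarith)
            have h5 : T ^ σ j ≤ T := by
              conv_rhs => rw [← Real.rpow_one T]
              exact Real.rpow_le_rpow_of_exponent_le hT1 (hσ1 j)
            calc a ^ (1 - γ * σ j) * T ^ σ j ≤ 1 * T :=
                  mul_le_mul h4 h5 (hA0 j).le zero_le_one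
              _ = T := one_mul _
        -- The factor 4 of the minors and the 4 in A_j are paid for by enlarging all m sides by 4,
        -- since m ≥ 2.
        have h6 : (16 : ℝ) ≤ 4 ^ m := by
          calc (16 : ℝ) = 4 ^ 2 := by norm_num
            _ ≤ 4 ^ m := pow_le_pow_right₀ (by norm_num) hm
        calc _ ≤ 4 * a ^ (1 - γ * σ j) * (4 * T ^ σ j) :=
              mul_le_mul_of_nonneg_right h1 (by linarith [hA0 j])
          _ = 16 * (a ^ (1 - γ * σ j) * T ^ σ j) := by ring
          _ ≤ 16 * T := by linarith
          _ ≤ 4 ^ m * T := mul_le_mul_of_nonneg_right h6 hT0.le)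
      hne
    refine hbox.mono (fun j => by rw [mul_assoc]) fun i => ?_
    rw [hρ1, mul_one, mul_assoc]

/-! ### Uniform transference from a linear form to simultaneous approximation. -/

/-- Among the integer points with `x` in a given box there is one at which the linear form has
minimal absolute value. -/
theorem exists_minimal_linear_form {m : ℕ} (Θ : Matrix (Fin 1) (Fin m) ℝ) (A : Fin m → ℝ)
    (h : ∃ (x : Fin m → ℤ) (y : ℤ), (x, y) ≠ 0 ∧ (∀ j, |(x j : ℝ)| ≤ A j) ∧
      |Θ.mulVec (fun j => (x j : ℝ)) 0 - y| ≤ 1) :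
    ∃ (x : Fin m → ℤ) (y : ℤ), (x, y) ≠ 0 ∧ (∀ j, |(x j : ℝ)| ≤ A j) ∧
      ∀ (x' : Fin m → ℤ) (y' : ℤ), (x', y') ≠ 0 → (∀ j, |(x' j : ℝ)| ≤ A j) →
        |Θ.mulVec (fun j => (x j : ℝ)) 0 - y| ≤ |Θ.mulVec (fun j => (x' j : ℝ)) 0 - y'| := by
  let l : (Fin m → ℤ) × ℤ → ℝ := fun z => |Θ.mulVec (fun j => (z.1 j : ℝ)) 0 - z.2|
  -- Restricting to values at most 1 bounds y as well and makes the set finite.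
  let S : Set ((Fin m → ℤ) × ℤ) := {z | z ≠ 0 ∧ (∀ j, |(z.1 j : ℝ)| ≤ A j) ∧ l z ≤ 1}
  have hne : S.Nonempty := by
    obtain ⟨x, y, h0, h1, h2⟩ := h
    exact ⟨(x, y), h0, h1, h2⟩
  let b : (Fin m → ℤ) × ℤ := (fun j => ⌈A j⌉, ⌈∑ j, |Θ 0 j| * A j + 1⌉)
  have hfin : S.Finite := by
    refine ((Set.finite_Icc (-b.1) b.1).prod (Set.finite_Icc (-b.2) b.2)).subset ?_
    rintro ⟨x, y⟩ ⟨-, hx, hl⟩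
    have hxb : ∀ j, |x j| ≤ ⌈A j⌉ := by
      intro j
      have h1 : ((|x j| : ℤ) : ℝ) ≤ (⌈A j⌉ : ℤ) := by
        push_cast
        exact (hx j).trans (Int.le_ceil _)
      exact_mod_cast h1
    have hyb : |y| ≤ ⌈∑ j, |Θ 0 j| * A j + 1⌉ := by
      have h1 : |Θ.mulVec (fun j => (x j : ℝ)) 0| ≤ ∑ j, |Θ 0 j| * A j := by
        rw [Matrix.mulVec, dotProduct]
        refine (Finset.abs_sum_le_sum_abs _ _).trans (Finset.sum_le_sum fun j _ => ?_)
        rw [abs_mul]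
        exact mul_le_mul_of_nonneg_left (hx j) (abs_nonneg _)
      have h2 : |Θ.mulVec (fun j => (x j : ℝ)) 0 - y| ≤ 1 := hl
      have h3 : ((|y| : ℤ) : ℝ) ≤ (⌈∑ j, |Θ 0 j| * A j + 1⌉ : ℤ) := by
        refine le_trans ?_ (Int.le_ceil _)
        push_cast
        have h4 := abs_le.1 h1
        have h5 := abs_le.1 h2
        rw [abs_le]
        constructor <;> linarith [h4.1, h4.2, h5.1, h5.2]
      exact_mod_cast h3
    exact ⟨⟨fun j => (abs_le.1 (hxb j)).1, fun j => (abs_le.1 (hxb j)).2⟩, abs_le.1 hyb⟩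
  obtain ⟨⟨x, y⟩, ⟨h0, hx, hl⟩, hmin⟩ := Set.exists_min_image S l hfin hne
  refine ⟨x, y, h0, hx, fun x' y' h0' hx' => ?_⟩
  by_cases h1 : l (x', y') ≤ 1
  · exact hmin (x', y') ⟨h0', hx', h1⟩
  · exact hl.trans (not_le.1 h1).le

/-- Uniform transference from a linear form to simultaneous approximation. -/
theorem le_weightedUniformExponent_col {m : ℕ} (hm : 2 ≤ m) {σ : Fin m → ℝ} {ρ : Fin 1 → ℝ}
    (hσ : IsWeight σ) (hρ : IsWeight ρ) {s : ℝ} (hs : ∀ j, s ≤ σ j) (hs0 : 0 < s) (hs1 : s < 1)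
    (Θ : Matrix (Fin 1) (Fin m) ℝ) {γ : ℝ} (hγ : 1 ≤ γ)
    (h : ∀ᶠ t : ℝ in Filter.atTop, HasNonzeroSolution σ ρ Θ 0 γ t) :
    (((1 - s / γ) / (1 - s) : ℝ) : EReal) ≤ weightedUniformExponent ρ σ Θ.transpose := by
  have hρ1 := hρ.apply_eq_one
  have hγ0 : 0 < γ := by linarith
  set τ := γ⁻¹ with hτ
  have hτ0 : 0 < τ := inv_pos.2 hγ0
  have hτ1 : τ ≤ 1 := inv_le_one_of_one_le₀ hγ
  have hτγ : τ * γ = 1 := inv_mul_cancel₀ hγ0.ne'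
  set β := (1 - s / γ) / (1 - s) with hβ
  -- The relation determining β: together with β ≥ 1 ≥ τ it gives (τ − β)σ_j ≤ 1 − β for every j.
  have hβeq : s * (τ - β) = 1 - β := by
    have h1 : β * (1 - s) = 1 - s / γ := div_mul_cancel₀ _ (by linarith)
    have h2 : s / γ = s * τ := div_eq_mul_inv _ _
    linarith
  have hβ1 : 1 ≤ β := by
    rw [hβ, le_div_iff₀ (by linarith), div_eq_mul_inv, ← hτ]
    nlinarith
  have hσ1 : ∀ j, σ j ≤ 1 := fun j => by
    rw [← hσ.sum_eq_one]
    exact Finset.single_le_sum (fun i _ => (hσ.pos i).le) (Finset.mem_univ j)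
  have hexp : ∀ j, τ * σ j - β * σ j ≤ 1 - β := fun j => by nlinarith [hs j]
  have hsol : ∀ t : ℝ, 0 < t → HasNonzeroSolution σ ρ Θ 0 γ t →
      ∃ (x : Fin m → ℤ) (y : ℤ), (x, y) ≠ 0 ∧ (∀ j, |(x j : ℝ)| ≤ t ^ σ j) ∧
        |Θ.mulVec (fun j => (x j : ℝ)) 0 - y| ≤ t ^ (-γ) := by
    intro t ht hs
    rw [hasNonzeroSolution_iff hσ.pos hρ.pos ht] at hs
    obtain ⟨x, y, h0, hx, hy⟩ := hs
    refine ⟨x, y 0, ?_, hx, ?_⟩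
    · intro h1
      apply h0
      rw [Prod.mk_eq_zero] at h1 ⊢
      refine ⟨h1.1, funext fun i => ?_⟩
      rw [Subsingleton.elim i 0]
      exact h1.2
    · have := hy 0
      beta_reduce at this
      rwa [Pi.zero_apply, sub_zero, hρ1, mul_one] at this
  obtain ⟨T₀, hT₀⟩ := Filter.eventually_atTop.1 h
  refine le_weightedUniformExponent_of_boxSolution (C := transferConst 1 m * 4)
    hρ.pos hσ.pos ?_
  filter_upwards [eventually_le_rpow hτ0 T₀, Filter.eventually_ge_atTop 1] with Q hQT hQ1
  have hQ0 : 0 < Q := by linarith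
  -- The height at which the uniform hypothesis gives a linear form of size at most V^(−γ) = 1/Q.
  set V := Q ^ τ with hV
  have hV0 : 0 < V := Real.rpow_pos_of_pos hQ0 _
  have hVσ : ∀ c, V ^ c = Q ^ (τ * c) := fun c => (Real.rpow_mul hQ0.le _ _).symm
  have hVγ : V ^ (-γ) = Q⁻¹ := by
    rw [hVσ, mul_neg, hτγ, Real.rpow_neg_one]
  have hQinv : Q⁻¹ ≤ 1 := inv_le_one_of_one_le₀ hQ1
  obtain ⟨x₁, y₁, h01, hx₁, hl₁⟩ := hsol V hV0 (hT₀ V hQT)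
  obtain ⟨x, y, h0, hx, hmin⟩ := exists_minimal_linear_form Θ (fun j => V ^ σ j)
    ⟨x₁, y₁, h01, hx₁, hl₁.trans (by rw [hVγ]; exact hQinv)⟩
  obtain ⟨l, hl⟩ : ∃ l : ℝ, l = Θ.mulVec (fun j => (x j : ℝ)) 0 - y := ⟨_, rfl⟩
  rw [← hl] at hmin
  have hlQ : |l| ≤ Q⁻¹ := (hmin x₁ y₁ h01 hx₁).trans (by rw [← hVγ]; exact hl₁)
  have hC0 : 0 ≤ transferConst 1 m := by rw [transferConst]; positivity
  have hδ0 : ∀ j, 0 < Q ^ (-β * σ j) := fun j => Real.rpow_pos_of_pos hQ0 _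
  have hprodδ : ∏ j, Q ^ (-β * σ j) = Q ^ (-β) := prod_rpow_weight hσ.sum_eq_one hQ0 _
  have hxδ : ∀ j, |(x j : ℝ)| * Q ^ (-β * σ j) ≤ Q ^ (1 - β) := by
    intro j
    refine (mul_le_mul_of_nonneg_right (hx j) (hδ0 j).le).trans ?_
    rw [hVσ, ← Real.rpow_add hQ0]
    apply Real.rpow_le_rpow_of_exponent_le hQ1
    linarith [hexp j]
  by_cases hcase : ∃ j, |l| * Q < |(x j : ℝ)| * Q ^ (-β * σ j)
  · obtain ⟨j₁, hj₁⟩ := hcase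
    have hP : (∏ i, Q ^ ρ i) * ∏ j, Q ^ (-β * σ j) = Q ^ (1 - β) := by
      rw [hprodδ, Fin.prod_univ_one, hρ1, ← Real.rpow_add hQ0, sub_eq_add_neg]
    have hbox := boxSolution_of_transpose one_pos (by omega) Θ.transpose
      (A := fun i => Q ^ ρ i) (fun i => Real.rpow_pos_of_pos hQ0 _) hδ0
      (q := x) (p := fun _ => y)
      (by
        intro h1
        apply h0
        rw [Prod.mk_eq_zero] at h1 ⊢
        exact ⟨h1.1, congrFun h1.2 0⟩)
      (by
        intro j
        rw [hP]
        exact hxδ j)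
      (by
        intro i
        rw [hP, hρ1, Real.rpow_one, Matrix.transpose_transpose, Subsingleton.elim i 0, ← hl]
        exact hj₁.le.trans (hxδ j₁))
    refine hbox.mono (fun i => ?_) fun j => ?_
    · rw [mul_assoc]
      refine mul_le_mul_of_nonneg_left ?_ hC0
      have := Real.rpow_nonneg hQ0.le (ρ i)
      linarith
    · rw [mul_assoc]
      exact mul_le_mul_of_nonneg_left (by linarith [hδ0 j]) hC0
  · push Not at hcase
    have hl0 : 0 < |l| := by
      rw [abs_pos]
      intro h1
      have hx0 : x = 0 := by
        ext j
        have h2 := hcase j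
        rw [h1, abs_zero, zero_mul] at h2
        have h3 : |(x j : ℝ)| ≤ 0 := nonpos_of_mul_nonpos_left h2 (hδ0 j)
        simpa using h3
      apply h0
      rw [Prod.mk_eq_zero]
      refine ⟨hx0, ?_⟩
      have : (y : ℝ) = 0 := by
        have e : Θ.mulVec (fun j => (x j : ℝ)) 0 = 0 := by
          simp [hx0, Matrix.mulVec, dotProduct]
        linarith
      exact_mod_cast this
    -- The height with t^(−γ) = |l|/2: its solution has |l'| ≤ |l|/2. Were it proportional to the
    -- first, x' would lie in the box of height V, against the minimality of |l|.
    set t := (|l| / 2) ^ (-τ) with ht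
    have ht0 : 0 < t := Real.rpow_pos_of_pos (by linarith) _
    have htγ : t ^ (-γ) = |l| / 2 := by
      rw [ht, ← Real.rpow_mul (by linarith), neg_mul_neg, hτγ, Real.rpow_one]
    have hVt : V ≤ t := by
      have h1 : |l| / 2 ≤ Q⁻¹ := by linarith
      have h2 := Real.rpow_le_rpow_of_nonpos (by linarith : 0 < |l| / 2) h1
        (by linarith : -τ ≤ 0)
      rw [Real.inv_rpow hQ0.le, Real.rpow_neg hQ0.le, inv_inv] at h2
      exact h2
    obtain ⟨x', y', h0', hx', hl'⟩ := hsol t ht0 (hT₀ t (hQT.trans hVt))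
    set l' := Θ.mulVec (fun j => (x' j : ℝ)) 0 - y' with hl'def
    rw [htγ] at hl'
    have hbox := boxSolution_col_of_pair hm Θ (δ := fun j => 4 * Q ^ (-β * σ j)) (Q := 4 * Q)
      (fun j => by linarith [hδ0 j]) (by linarith) hl hl'def
      (fun j => by linarith [hcase j])
      (by
        intro j
        rw [Finset.prod_mul_distrib, hprodδ, Finset.prod_const, Finset.card_univ,
          Fintype.card_fin]
        have htσ : 0 ≤ t ^ σ j := Real.rpow_nonneg ht0.le _
        have h1 : |l * x' j - l' * x j| ≤ 4 * t ^ (σ j - γ) := by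
          have h2 : V ^ σ j ≤ t ^ σ j := Real.rpow_le_rpow hV0.le hVt (hσ.pos j).le
          have h3 : t ^ (σ j - γ) = t ^ σ j * (|l| / 2) := by
            rw [sub_eq_add_neg, Real.rpow_add ht0, htγ]
          calc |l * x' j - l' * x j| ≤ |l| * |(x' j : ℝ)| + |l'| * |(x j : ℝ)| := by
                rw [← abs_mul, ← abs_mul]; exact abs_sub _ _
            _ ≤ |l| * t ^ σ j + |l| / 2 * t ^ σ j := by
                have := hx' j
                have := (hx j).trans h2
                gcongr
            _ ≤ _ := by
                rw [h3]
                nlinarith [mul_nonneg hl0.le htσ]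
        have h4 : t ^ (σ j - γ) ≤ Q ^ (τ * (σ j - γ)) := by
          rw [← hVσ]
          exact Real.rpow_le_rpow_of_nonpos hV0 hVt (by linarith [hσ1 j])
        have h5 : t ^ (σ j - γ) * Q ^ (-β * σ j) ≤ Q ^ (-β) := by
          refine (mul_le_mul_of_nonneg_right h4 (hδ0 j).le).trans ?_
          rw [← Real.rpow_add hQ0]
          apply Real.rpow_le_rpow_of_exponent_le hQ1
          linarith [hexp j]
        have h6 : (16 : ℝ) ≤ 4 ^ m := by
          calc (16 : ℝ) = 4 ^ 2 := by norm_num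
            _ ≤ 4 ^ m := pow_le_pow_right₀ (by norm_num) hm
        have h7 : 0 ≤ Q ^ (-β) := Real.rpow_nonneg hQ0.le _
        calc _ ≤ 4 * t ^ (σ j - γ) * (4 * Q ^ (-β * σ j)) :=
              mul_le_mul_of_nonneg_right h1 (by linarith [hδ0 j])
          _ = 16 * (t ^ (σ j - γ) * Q ^ (-β * σ j)) := by ring
          _ ≤ 16 * Q ^ (-β) := by linarith
          _ ≤ 4 ^ m * Q ^ (-β) := mul_le_mul_of_nonneg_right h6 h7)
      (by
        by_contra hcon
        push Not at hcon
        have h1 : ∀ j, |(x' j : ℝ)| ≤ V ^ σ j := by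
          intro j
          refine le_trans ?_ (hx j)
          have h2 : |l| * |(x' j : ℝ)| = |l'| * |(x j : ℝ)| := by
            rw [← abs_mul, ← abs_mul, sub_eq_zero.1 (hcon j)]
          refine le_of_mul_le_mul_left ?_ hl0
          rw [h2]
          exact mul_le_mul_of_nonneg_right (by linarith) (abs_nonneg _)
        have := hmin x' y' h0' h1
        linarith)
    refine hbox.mono (fun i => ?_) fun j => by rw [mul_assoc]
    rw [hρ1, Real.rpow_one, mul_assoc]

/-! ### Combination of duality and transference. -/

theorem lastEntry_le {k : ℕ} (hk : 0 < k) {w : Fin k → ℝ} (hw : IsWeight w) (i : Fin k) :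
    lastEntry hk w ≤ w i :=
  hw.anti (Fin.le_def.2 (by simp only; omega))

theorem lastEntry_lt_one {k : ℕ} (hk : 0 < k) (hk2 : 2 ≤ k) {w : Fin k → ℝ} (hw : IsWeight w) :
    lastEntry hk w < 1 := by
  have h : ∑ i, w i = 1 := hw.sum_eq_one
  rw [← h]
  refine Finset.single_lt_sum (i := ⟨k - 1, by omega⟩) (j := ⟨0, hk⟩) ?_ (Finset.mem_univ _)
    (Finset.mem_univ _) (hw.pos _) fun i _ _ => (hw.pos i).le
  rw [Ne, Fin.mk.injEq]
  omega

theorem ne_bot_of_one_le {a : EReal} (h : 1 ≤ a) : a ≠ ⊥ :=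
  ((EReal.bot_lt_coe 1).trans_le h).ne'

theorem le_coe_of_forall_coe_lt {a : EReal} {B : ℝ} (h : ∀ g : ℝ, (g : EReal) < a → g ≤ B) :
    a ≤ B := by
  refine le_of_forall_lt fun c hc => ?_
  obtain ⟨g, hcg, hga⟩ := EReal.lt_iff_exists_real_btwn.1 hc
  exact hcg.trans_le (EReal.coe_le_coe_iff.2 (h g hga))

theorem weightedExponent_le_of_forall {m n : ℕ} {σ : Fin m → ℝ} {ρ : Fin n → ℝ}
    {Θ : Matrix (Fin n) (Fin m) ℝ} {B : ℝ} (hB : 1 ≤ B)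
    (h : ∀ γ : ℝ, 1 ≤ γ → (∃ᶠ t : ℝ in Filter.atTop, HasNonzeroSolution σ ρ Θ 0 γ t) → γ ≤ B) :
    weightedExponent σ ρ Θ ≤ B := by
  refine le_coe_of_forall_coe_lt fun γ hγ => ?_
  rcases le_total γ 1 with h1 | h1
  · exact h1.trans hB
  · exact h γ h1 (Filter.frequently_atTop.2 fun T => frequently_of_lt_inhomExponent hγ T)

theorem weightedUniformExponent_le_of_forall {m n : ℕ} {σ : Fin m → ℝ} {ρ : Fin n → ℝ}
    {Θ : Matrix (Fin n) (Fin m) ℝ} {B : ℝ} (hB : 1 ≤ B)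
    (h : ∀ γ : ℝ, 1 ≤ γ → (∀ᶠ t : ℝ in Filter.atTop, HasNonzeroSolution σ ρ Θ 0 γ t) → γ ≤ B) :
    weightedUniformExponent σ ρ Θ ≤ B := by
  refine le_coe_of_forall_coe_lt fun γ hγ => ?_
  rcases le_total γ 1 with h1 | h1
  · exact h1.trans hB
  · exact h γ h1 (Filter.eventually_atTop.2 (eventually_of_lt_inhomUniformExponent hγ))

/-- Needed when ω = +∞, where the claimed lower bound is 0. For negative exponents the allowed error
tends to infinity, so a fixed nonzero vector works. -/
theorem zero_le_inhomUniformExponent {m n : ℕ} (hn : 0 < n) {σ : Fin m → ℝ} {ρ : Fin n → ℝ}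
    (hσ : IsWeight σ) (hρ : IsWeight ρ) (Θ : Matrix (Fin n) (Fin m) ℝ) (η : Fin n → ℝ) :
    0 ≤ inhomUniformExponent σ ρ Θ η := by
  refine coe_le_of_forall_lt (a := 0) fun g hg => le_inhomUniformExponent
    (Filter.eventually_atTop.1 ?_)
  have hev : ∀ᶠ t : ℝ in Filter.atTop, ∀ i, |(1 : ℝ) + η i| ≤ t ^ (-g * ρ i) :=
    Filter.eventually_all.2 fun i => eventually_le_rpow (mul_pos (neg_pos.2 hg) (hρ.pos i)) _
  filter_upwards [hev, Filter.eventually_gt_atTop 0] with t ht ht0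
  rw [hasNonzeroSolution_iff hσ.pos hρ.pos ht0]
  refine ⟨0, fun _ => 1, ?_, fun j => ?_, fun i => ?_⟩
  · intro h
    have := congrFun (congrArg Prod.snd h) ⟨0, hn⟩
    simp at this
  · simpa using Real.rpow_nonneg ht0.le (σ j)
  · have e : Θ.mulVec (fun j => (((0 : Fin m → ℤ) j : ℤ) : ℝ)) i = 0 := by
      simp [Matrix.mulVec, dotProduct]
    rw [e, show (0 : ℝ) - ((1 : ℤ) : ℝ) - η i = -(1 + η i) by push_cast; ring, abs_neg]
    exact ht i

theorem inhomUniformExponent_row_ge {m : ℕ} (hm : 2 ≤ m) {σ : Fin m → ℝ} {ρ : Fin 1 → ℝ}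
    (hσ : IsWeight σ) (hρ : IsWeight ρ) {s : ℝ} (hs : ∀ j, s ≤ σ j) (hs0 : 0 < s)
    (Θ : Matrix (Fin 1) (Fin m) ℝ) (η : Fin 1 → ℝ) :
    (s : EReal) / (weightedExponent σ ρ Θ - ((1 - s : ℝ) : EReal))
      ≤ inhomUniformExponent σ ρ Θ η := by
  have h1 := one_le_weightedExponent hσ hρ Θ
  rcases eq_or_ne (weightedExponent σ ρ Θ) ⊤ with htop | htop
  · rw [htop, EReal.top_sub_coe, EReal.div_top]
    exact zero_le_inhomUniformExponent one_pos hσ hρ Θ η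
  · lift weightedExponent σ ρ Θ to ℝ using ⟨htop, ne_bot_of_one_le h1⟩ with r hr
    have hr1 : 1 ≤ r := by exact_mod_cast h1
    have hB : weightedExponent ρ σ Θ.transpose ≤ (((r - (1 - s)) / s : ℝ) : EReal) := by
      refine weightedExponent_le_of_forall ?_ fun γ hγ hfreq => ?_
      · rw [le_div_iff₀ hs0]; linarith
      · have := le_weightedExponent_row (by omega) hσ hρ hs Θ hγ hfreq
        rw [← hr] at this
        have h2 : (1 - s) + s * γ ≤ r := by exact_mod_cast this
        rw [le_div_iff₀ hs0]
        linarith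
    have := inv_le_inhomUniformExponent hσ hρ Θ η hB
    rw [inv_div] at this
    exact_mod_cast this

theorem inhomExponent_row_ge {m : ℕ} (hm : 2 ≤ m) {σ : Fin m → ℝ} {ρ : Fin 1 → ℝ}
    (hσ : IsWeight σ) (hρ : IsWeight ρ) {s : ℝ} (hs : ∀ j, s ≤ σ j) (hs0 : 0 < s) (hs1 : s < 1)
    (Θ : Matrix (Fin 1) (Fin m) ℝ) (hΘ : ∃ j, Irrational (Θ 0 j)) (η : Fin 1 → ℝ) :
    (s : EReal) / (1 - ((1 - s : ℝ) : EReal) * (weightedUniformExponent σ ρ Θ)⁻¹)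
      ≤ inhomExponent σ ρ Θ η := by
  have h1 := one_le_weightedUniformExponent hσ hρ Θ
  -- Here k = 1/ω̂, with value 0 when ω̂ = +∞; this handles both cases at once.
  obtain ⟨k, hk, hk1, hkle⟩ : ∃ k : ℝ, (weightedUniformExponent σ ρ Θ)⁻¹ = (k : EReal) ∧ k ≤ 1 ∧
      ∀ b : ℝ, 0 < b → (b : EReal) ≤ weightedUniformExponent σ ρ Θ → k ≤ b⁻¹ := by
    rcases eq_or_ne (weightedUniformExponent σ ρ Θ) ⊤ with htop | htop
    · refine ⟨0, by rw [htop]; simp, zero_le_one, fun b hb _ => (inv_pos.2 hb).le⟩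
    · lift weightedUniformExponent σ ρ Θ to ℝ using ⟨htop, ne_bot_of_one_le h1⟩ with r hr
      have hr1 : 1 ≤ r := by exact_mod_cast h1
      refine ⟨r⁻¹, (EReal.coe_inv r).symm, inv_le_one_of_one_le₀ hr1, fun b hb hbr => ?_⟩
      exact inv_anti₀ hb (by exact_mod_cast hbr)
  have hmul : ∀ γ : ℝ, 1 ≤ γ → s * γ < 1 →
      (∀ᶠ t : ℝ in Filter.atTop, HasNonzeroSolution ρ σ Θ.transpose 0 γ t) →
      γ ≤ (1 - (1 - s) * k) / s := by
    intro γ hγ hsγ hev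
    have h2 := hkle _ (div_pos (by linarith) (by linarith))
      (le_weightedUniformExponent_row hm hσ hρ hs hs0 hs1 Θ hΘ hγ hsγ hev)
    rw [inv_div, le_div_iff₀ (by linarith)] at h2
    rw [le_div_iff₀ hs0]
    linarith
  have hB : weightedUniformExponent ρ σ Θ.transpose ≤ (((1 - (1 - s) * k) / s : ℝ) : EReal) := by
    refine weightedUniformExponent_le_of_forall ?_ fun γ hγ hev => ?_
    · rw [le_div_iff₀ hs0]; nlinarith
    · rcases (mul_le_one_of_eventually hσ hρ hs Θ hΘ (by linarith) hev).lt_or_eq with h2 | h2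
      · exact hmul γ hγ h2 hev
      -- At sγ = 1 the transference bound degenerates; it is applied to g < γ and g tends to γ.
      · have hγ1 : 1 < γ := by
          by_contra h3
          nlinarith
        refine le_of_forall_lt fun c hc => ?_
        obtain ⟨g, hg1, hg2⟩ := exists_between (max_lt hc hγ1)
        refine ((le_max_left _ _).trans_lt hg1).trans_le (hmul g
          ((le_max_right _ _).trans hg1.le) ?_ ?_)
        · rw [← h2]; exact mul_lt_mul_of_pos_left hg2 hs0
        · filter_upwards [hev, Filter.eventually_ge_atTop 1] with t ht ht1
          exact ht.anti ht1 hg2.le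
  have := inv_le_inhomExponent hσ hρ Θ η hB
  rw [inv_div] at this
  rw [hk]
  exact_mod_cast this

theorem exponents_col_ge {m : ℕ} (hm : 2 ≤ m) {σ : Fin m → ℝ} {ρ : Fin 1 → ℝ}
    (hσ : IsWeight σ) (hρ : IsWeight ρ) {s : ℝ} (hs : ∀ j, s ≤ σ j) (hs0 : 0 < s) (hs1 : s < 1)
    (Θ : Matrix (Fin m) (Fin 1) ℝ) (η : Fin m → ℝ)
    (hω : weightedExponent ρ σ Θ < (((1 - s)⁻¹ : ℝ) : EReal)) :
    ((weightedExponent ρ σ Θ)⁻¹ - ((1 - s : ℝ) : EReal)) / (s : EReal)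
        ≤ inhomUniformExponent ρ σ Θ η ∧
      (1 - ((1 - s : ℝ) : EReal) * weightedUniformExponent ρ σ Θ) / (s : EReal)
        ≤ inhomExponent ρ σ Θ η := by
  have h1 := one_le_weightedExponent hρ hσ Θ
  have h1' := one_le_weightedUniformExponent hρ hσ Θ
  have hle : weightedUniformExponent ρ σ Θ ≤ weightedExponent ρ σ Θ :=
    inhomUniformExponent_le_inhomExponent
  have hs' : 0 < 1 - s := by linarith
  constructor
  · lift weightedExponent ρ σ Θ to ℝ using ⟨hω.ne_top, ne_bot_of_one_le h1⟩ with r hr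
    have hr1 : 1 ≤ r := by exact_mod_cast h1
    have hr0 : 0 < r := by linarith
    have hrs : r < (1 - s)⁻¹ := by exact_mod_cast hω
    -- The hypothesis on ω enters here: it makes the denominator of the bound for the transposed
    -- exponent positive.
    have hd : 0 < r⁻¹ - (1 - s) := by
      have := (lt_inv_comm₀ hr0 hs').1 hrs
      linarith
    have hrinv : r⁻¹ ≤ 1 := inv_le_one_of_one_le₀ hr1
    have hB : weightedExponent σ ρ Θ.transpose ≤ ((s / (r⁻¹ - (1 - s)) : ℝ) : EReal) := by
      refine weightedExponent_le_of_forall ?_ fun γ hγ hfreq => ?_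
      · rw [le_div_iff₀ hd]; linarith
      · have h2 := le_weightedExponent_col (by omega) hσ hρ hs hs0 hs1 Θ.transpose hγ hfreq
        rw [Matrix.transpose_transpose, ← hr] at h2
        have h3 : γ / (γ * (1 - s) + s) ≤ r := by exact_mod_cast h2
        have hγ0 : 0 < γ := by linarith
        rw [div_le_iff₀ (by positivity)] at h3
        have h4 : r⁻¹ * γ ≤ γ * (1 - s) + s := by
          rw [inv_mul_le_iff₀ hr0]; exact h3
        rw [le_div_iff₀ hd]
        linarith
    have := inv_le_inhomUniformExponent hρ hσ Θ η hB
    rw [inv_div] at this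
    exact_mod_cast this
  · have hω' := hle.trans_lt hω
    lift weightedUniformExponent ρ σ Θ to ℝ using ⟨hω'.ne_top, ne_bot_of_one_le h1'⟩
      with r hr
    have hr1 : 1 ≤ r := by exact_mod_cast h1'
    have hrs : r < (1 - s)⁻¹ := by exact_mod_cast hω'
    have hd : 0 < 1 - (1 - s) * r := by
      have := mul_lt_mul_of_pos_left hrs hs'
      rw [mul_inv_cancel₀ hs'.ne'] at this
      linarith
    have hB : weightedUniformExponent σ ρ Θ.transpose
        ≤ ((s / (1 - (1 - s) * r) : ℝ) : EReal) := by
      refine weightedUniformExponent_le_of_forall ?_ fun γ hγ hev => ?_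
      · rw [le_div_iff₀ hd]; nlinarith
      · have h2 := le_weightedUniformExponent_col hm hσ hρ hs hs0 hs1 Θ.transpose hγ hev
        rw [Matrix.transpose_transpose, ← hr] at h2
        have h3 : (1 - s / γ) / (1 - s) ≤ r := by exact_mod_cast h2
        have hγ0 : 0 < γ := by linarith
        rw [div_le_iff₀ hs'] at h3
        have h4 : 1 - (1 - s) * r ≤ s / γ := by linarith
        rw [le_div_iff₀ hγ0] at h4
        rw [le_div_iff₀ hd]
        linarith
    have := inv_le_inhomExponent hρ hσ Θ η hB
    rw [inv_div] at this
    exact_mod_cast this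

theorem theoremt {m n : ℕ} (hm : 0 < m) (hn : 0 < n) (hmn : 3 ≤ n + m)
    (σ : Fin m → ℝ) (ρ : Fin n → ℝ) (hσ : IsWeight σ) (hρ : IsWeight ρ)
    (Θ : Matrix (Fin n) (Fin m) ℝ) (η : Fin n → ℝ) :
    (n = 1 →
      ((lastEntry hm σ : ℝ) : EReal) /
          (weightedExponent σ ρ Θ - ((1 - lastEntry hm σ : ℝ) : EReal))
        ≤ inhomUniformExponent σ ρ Θ η ∧
      ((∃ i j, Irrational (Θ i j)) →
        ((lastEntry hm σ : ℝ) : EReal) /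
            (1 - ((1 - lastEntry hm σ : ℝ) : EReal) * (weightedUniformExponent σ ρ Θ)⁻¹)
          ≤ inhomExponent σ ρ Θ η)) ∧
    (m = 1 →
      weightedExponent σ ρ Θ < (((1 - lastEntry hn ρ)⁻¹ : ℝ) : EReal) →
      ((weightedExponent σ ρ Θ)⁻¹ - ((1 - lastEntry hn ρ : ℝ) : EReal)) /
          ((lastEntry hn ρ : ℝ) : EReal)
        ≤ inhomUniformExponent σ ρ Θ η ∧
      (1 - ((1 - lastEntry hn ρ : ℝ) : EReal) * weightedUniformExponent σ ρ Θ) /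
          ((lastEntry hn ρ : ℝ) : EReal)
        ≤ inhomExponent σ ρ Θ η) := by
  constructor
  · rintro rfl
    have hm2 : 2 ≤ m := by omega
    refine ⟨inhomUniformExponent_row_ge hm2 hσ hρ (lastEntry_le hm hσ) (hσ.pos _) Θ η, ?_⟩
    rintro ⟨i, j, hij⟩
    rw [Subsingleton.elim i 0] at hij
    exact inhomExponent_row_ge hm2 hσ hρ (lastEntry_le hm hσ) (hσ.pos _)
      (lastEntry_lt_one hm hm2 hσ) Θ ⟨j, hij⟩ η
  · rintro rfl hω
    have hn2 : 2 ≤ n := by omega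
    exact exponents_col_ge hn2 hρ hσ (lastEntry_le hn hρ) (hρ.pos _)
      (lastEntry_lt_one hn hn2 hρ) Θ η hω
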